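/- Let $\theta_p=p\,\partial/\partial p$, $\theta_q=q\,\partial/\partial q$, $\theta_r=r\,\partial/\partial r$ be the Euler operators on $\mathbb C^3={\rm Spec}\,\mathbb C[p,q,r]$, and consider the system of linear partial differential equations (the Picard–Fuchs system of the family of Kummer surfaces $y^2=x(x+t^2)(x+t^3+pt^2+qt+r)$) $$ \begin{aligned} & q^2\theta_p\theta_r u=pr\,\theta_q(\theta_q-1)u,\\ & p^2\theta_q(\theta_q+2\theta_r)u=q\,\theta_p(\theta_p-1)u,\\ & \theta_p(\theta_p+2\theta_q+3\theta_r)u=p\left(\theta_p+2\theta_q+3\theta_r+\tfrac12\right)^2u,\\ & pq\,\theta_r(\theta_q+2\theta_r)u=r\,\theta_p\theta_q u,\\ & 9qr\,\theta_p(1+2\theta_r)u-4pr\,\theta_q(2\theta_q+3\theta_r)u-4p^2q\,\theta_r(\theta_q+2\theta_r)u\\ &\qquad+4p^2r\,\theta_q(\theta_p+4\theta_q+6\theta_r)u+pq^2\theta_r(1+16\theta_q+30\theta_r)u=0 . \end{aligned} $$ Let $I$ be the left ideal generated by the five corresponding operators (left-hand side minus right-hand side, exactly as written) in the Weyl algebra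 $\mathbb C[p,q,r]\langle\partial_p,\partial_q,\partial_r\rangle$. The singular locus of the system is the set of $x\in\mathbb C^3$ for which there is a covector $\xi\in\mathbb C^3\setminus\{0\}$ such that the principal symbol of every operator in $I$ vanishes at $(x,\xi)$; that is, it is the projection to $\mathbb C^3$ of the characteristic variety of the system with the zero section removed. Put $$ \begin{aligned} d_1={}&-q^4+2pq^4-4q^2r+15pq^2r-15p^2q^2r+6q^3r+12pr^2-36p^2r^2+24p^3r^2-81r^3,\\ d_2={}&-q^2+2pq^2-p^2q^2+4q^3-4r+12pr-12p^2r+4p^3r+18qr-18pqr+27r^2,\\ d_3={}&-p^2q^2+4q^3+4p^3r-18pqr+27r^2 . \end{aligned} $$ Then the singular locus of the system is $$\{p=0\}\cup\{q=0\}\cup\{r=0\}\cup\{d_2=0\}\cup\{d_3=0\}\subset\mathbb C^3 .$$ Here $-d_2$ and $-d_3$ are the discriminants, with respect to $t$, of the cubics $R_2(t)=t^3-t^2+pt^2+qt+r$ and $R_3(t)=t^3+pt^2+qt+r$. The hypersurface $\{d_1=0\}$ is not contained in the singular locus. -/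

import Mathlib

namespace KummerPF

noncomputable section

/-- The coordinate ring `ℂ[p, q, r]` of `ℂ³`; the variables `0, 1, 2` are `p, q, r`. -/
abbrev Poly : Type := MvPolynomial (Fin 3) ℂ

/-- Multiplication by the `i`-th coordinate, as a `ℂ`-linear operator on `ℂ[p, q, r]`. -/
def mulX (i : Fin 3) : Module.End ℂ Poly := LinearMap.mulLeft ℂ (MvPolynomial.X i)

/-- The partial derivative in the `i`-th coordinate, as a `ℂ`-linear operator on `ℂ[p, q, r]`. -/
def partialD (i : Fin 3) : Module.End ℂ Poly :=
  (MvPolynomial.pderiv i : Derivation ℂ Poly Poly).toLinearMap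

/-- The Weyl algebra `ℂ[p, q, r]⟨∂_p, ∂_q, ∂_r⟩` of linear differential operators with polynomial
coefficients. In characteristic zero it acts faithfully on `ℂ[p, q, r]`, so it is the algebra of
operators generated by the coordinates and the partial derivatives. -/
def Weyl : Subalgebra ℂ (Module.End ℂ Poly) :=
  Algebra.adjoin ℂ (Set.range mulX ∪ Set.range partialD)

/-- The `i`-th coordinate, as an element of the Weyl algebra. -/
def coord (i : Fin 3) : Weyl := ⟨mulX i, Algebra.subset_adjoin (Or.inl ⟨i, rfl⟩)⟩

/-- The `i`-th partial derivative, as an element of the Weyl algebra. -/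
def del (i : Fin 3) : Weyl := ⟨partialD i, Algebra.subset_adjoin (Or.inr ⟨i, rfl⟩)⟩

/-- The Euler operator `θ = x ∂/∂x` in the `i`-th coordinate. -/
def euler (i : Fin 3) : Weyl := coord i * del i

/-- The operator `∑ a_α(p, q, r) ∂^α` with total symbol `f = ∑ a_α(p, q, r) ξ^α`. Here `f` is a
polynomial in the dual variables `ξ` with coefficients in `ℂ[p, q, r]`. Every element of the Weyl
algebra is of this form for exactly one `f`. -/
def ofSymbol (f : MvPolynomial (Fin 3) Poly) : Module.End ℂ Poly :=
  ∑ α ∈ f.support, LinearMap.mulLeft ℂ (f.coeff α) *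
    (partialD 0 ^ α 0 * partialD 1 ^ α 1 * partialD 2 ^ α 2)

/-- The value at `(x, ξ)` of the principal symbol of the operator with total symbol `f`, that is, of
the part of `f` of highest degree in `ξ`. -/
def principalSymbolAt (f : MvPolynomial (Fin 3) Poly) (x ξ : Fin 3 → ℂ) : ℂ :=
  MvPolynomial.eval ξ
    (MvPolynomial.map (MvPolynomial.eval x) (MvPolynomial.homogeneousComponent f.totalDegree f))

/-- The characteristic variety in `T*ℂ³ = ℂ³ × ℂ³` of the system `L u = 0 (L ∈ I)`: the common zeros
of the principal symbols of all operators in the left ideal `I`. -/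
def charVariety (I : Ideal Weyl) : Set ((Fin 3 → ℂ) × (Fin 3 → ℂ)) :=
  {z | ∀ L ∈ I, ∀ f : MvPolynomial (Fin 3) Poly,
    ofSymbol f = (L : Module.End ℂ Poly) → principalSymbolAt f z.1 z.2 = 0}

/-- The singular locus of the system `L u = 0 (L ∈ I)`: the image in `ℂ³` of the characteristic
variety with the zero section removed. -/
def singularLocus (I : Ideal Weyl) : Set (Fin 3 → ℂ) :=
  {x | ∃ ξ : Fin 3 → ℂ, ξ ≠ 0 ∧ (x, ξ) ∈ charVariety I}

section System

local notation "p" => coord 0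
local notation "q" => coord 1
local notation "r" => coord 2
local notation "θp" => euler 0
local notation "θq" => euler 1
local notation "θr" => euler 2

/-- `q² θ_p θ_r u = p r θ_q (θ_q - 1) u`. -/
def gkz1 : Weyl := q ^ 2 * θp * θr - p * r * θq * (θq - 1)

/-- `p² θ_q (θ_q + 2 θ_r) u = q θ_p (θ_p - 1) u`. -/
def gkz2 : Weyl := p ^ 2 * θq * (θq + 2 * θr) - q * θp * (θp - 1)

/-- `θ_p (θ_p + 2 θ_q + 3 θ_r) u = p (θ_p + 2 θ_q + 3 θ_r + 1/2)² u`. -/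
def gkz3 : Weyl :=
  θp * (θp + 2 * θq + 3 * θr) -
    p * (θp + 2 * θq + 3 * θr + algebraMap ℂ Weyl (1 / 2)) ^ 2

/-- `p q θ_r (θ_q + 2 θ_r) u = r θ_p θ_q u`. -/
def gkz4 : Weyl := p * q * θr * (θq + 2 * θr) - r * θp * θq

/-- The further equation of the Picard–Fuchs system, not implied by the four equations above. -/
def newEq : Weyl :=
  9 * q * r * θp * (1 + 2 * θr)
    - 4 * p * r * θq * (2 * θq + 3 * θr)
    - 4 * p ^ 2 * q * θr * (θq + 2 * θr)
    + 4 * p ^ 2 * r * θq * (θp + 4 * θq + 6 * θr)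
    + p * q ^ 2 * θr * (1 + 16 * θq + 30 * θr)

end System

/-- The left ideal of the Weyl algebra generated by the five operators of the Picard–Fuchs system
(`Ideal` means left ideal over a noncommutative ring). -/
def picardFuchs : Ideal Weyl := Ideal.span {gkz1, gkz2, gkz3, gkz4, newEq}

/-- The factor `d₁` of the denominators of the Pfaffian form for the basis
`u, θ_p u, θ_q u, θ_r u, θ_p² u`. -/
def d₁ (p q r : ℂ) : ℂ :=
  -q ^ 4 + 2 * p * q ^ 4 - 4 * q ^ 2 * r + 15 * p * q ^ 2 * r - 15 * p ^ 2 * q ^ 2 * r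
    + 6 * q ^ 3 * r + 12 * p * r ^ 2 - 36 * p ^ 2 * r ^ 2 + 24 * p ^ 3 * r ^ 2 - 81 * r ^ 3

/-- The polynomial `d₂`. -/
def d₂ (p q r : ℂ) : ℂ :=
  -q ^ 2 + 2 * p * q ^ 2 - p ^ 2 * q ^ 2 + 4 * q ^ 3 - 4 * r + 12 * p * r - 12 * p ^ 2 * r
    + 4 * p ^ 3 * r + 18 * q * r - 18 * p * q * r + 27 * r ^ 2

/-- The polynomial `d₃`. -/
def d₃ (p q r : ℂ) : ℂ :=
  -p ^ 2 * q ^ 2 + 4 * q ^ 3 + 4 * p ^ 3 * r - 18 * p * q * r + 27 * r ^ 2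

/-- The cubic `R₂(t) = t³ - t² + p t² + q t + r`. -/
def R₂ (p q r : ℂ) : Cubic ℂ := ⟨1, p - 1, q, r⟩

/-- The cubic `R₃(t) = t³ + p t² + q t + r`. -/
def R₃ (p q r : ℂ) : Cubic ℂ := ⟨1, p, q, r⟩

end

end KummerPF

/-!
The Picard–Fuchs system annihilates the periods `u = ∮ F(z) dt / t`, where
`z = t + p + q / t + r / t²` and `F = ∑ ((1/2)_k / k!)² z ^ k` is the elliptic period, a solution of
the hypergeometric equation. This holds before integration: each of the five generators sends
`F(z)` to `t ∂/∂t` of an explicit expression in `F(z)` and `F'(z)` (`gkz1_period`, …,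
`newEq_period`). These identities are formal, so they remain true for the distribution
obtained by cutting off a power series solution, in `y = z - ε`, along `y = 0`, provided `ε` is one
of the singular points `0`, `1` of the hypergeometric equation. Applying an operator `L` of order
`m` to the cut-off period `w` gives a leading term at `δ^(m-1)(y)`, whose coefficient is the
principal symbol of `L` at the covector `dz = (1, 1 / t, 1 / t²)`. If `L` belongs to the ideal then
`L w` is a derivative `t ∂c/∂t`, and the leading coefficient of such a derivative is divisible by
`t ∂z/∂t` (`zDot_dvd_tEuler`). Hence the principal symbol vanishes at `dz` as soon as
`z = ε` and `∂z/∂t = 0`, that is, if the numerator `t³ + (p - ε) t² + q t + r` has the double root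
`t` (`doubleRoot_mem_charVariety`). This puts `d₃ = 0` (for `ε = 0`) and `d₂ = 0` (for `ε = 1`) into
the singular locus.

For a coordinate plane, the generators of the ideal are polynomials in the coordinates and the
Euler operators, which commute with the cut-off of a power series in `p, q, r` to nonnegative
exponents, viewed as a distribution. The holomorphic period (the constant term in `t` of `F(z)`),
cut off in this way, is therefore annihilated by the ideal, and comparing the coefficients of the
most singular terms shows that the conormal direction of the plane is characteristic
(`coordHyperplane_mem_charVariety`).

Conversely, outside the coordinate planes the symbols of the first four generators already
suffice: they are quadrics in the covector `ξ`, and a nonzero common zero is proportional to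
`(t², t, 1)` with `t` a double root of one of the two cubics
(`discriminant_eq_zero_of_mem_charVariety`).

All this is algebraic: functions on the line cut off at `0`, together with the derivatives of `δ`,
are formal sums `∑ c_k e_k` over `k ∈ ℤ`, where `e_k` is `y ^ k / k!` for `k ≥ 0` and `δ^(-k-1)` for
`k < 0`. With this normalisation `y e_k = (k + 1) e_{k+1}` and `∂ e_k = e_{k-1}` for all `k`.
-/

namespace KummerPF

noncomputable section

/-! ### Representations of the Weyl algebra -/

section Representations

open MvPolynomial

/-- Operators `X 0, X 1, X 2, D 0, D 1, D 2` on a complex vector space satisfying the defining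
relations of the Weyl algebra in three variables. -/
structure IsWeylRep {M : Type*} [AddCommGroup M] [Module ℂ M] (X D : Fin 3 → Module.End ℂ M) :
    Prop where
  comm_X : ∀ i j, X i * X j = X j * X i
  comm_D : ∀ i j, D i * D j = D j * D i
  D_mul_X : ∀ i j, D i * X j = X j * D i + if i = j then 1 else 0

section Act

variable {M : Type*} [AddCommGroup M] [Module ℂ M]

/-- The monomial `T₀ ^ α₀ * T₁ ^ α₁ * T₂ ^ α₂` in a triple of operators. -/
def opPow (T : Fin 3 → Module.End ℂ M) (α : Fin 3 →₀ ℕ) : Module.End ℂ M :=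
  T 0 ^ α 0 * T 1 ^ α 1 * T 2 ^ α 2

/-- The operator `g(X₀, X₁, X₂)` for a polynomial `g`. -/
def polyAct (X : Fin 3 → Module.End ℂ M) (g : Poly) : Module.End ℂ M :=
  (AddMonoidAlgebra.coeff g).sum fun β c => c • opPow X β

/-- The operator `∑ a_α(X) D ^ α` with total symbol `f = ∑ a_α ξ ^ α`. -/
def symAct (X D : Fin 3 → Module.End ℂ M) (f : MvPolynomial (Fin 3) Poly) : Module.End ℂ M :=
  (AddMonoidAlgebra.coeff f).sum fun α g => polyAct X g * opPow D α

/-- Differentiation of the coefficients of a total symbol. -/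
def coeffDeriv (i : Fin 3) (f : MvPolynomial (Fin 3) Poly) : MvPolynomial (Fin 3) Poly :=
  (AddMonoidAlgebra.coeff f).sum fun α g => monomial α (pderiv i g)

lemma opPow_zero (T : Fin 3 → Module.End ℂ M) : opPow T 0 = 1 := by simp [opPow]

lemma opPow_add_single {T : Fin 3 → Module.End ℂ M} (hT : ∀ i j, T i * T j = T j * T i)
    (α : Fin 3 →₀ ℕ) (i : Fin 3) : opPow T (α + Finsupp.single i 1) = opPow T α * T i := by
  have h1 : Commute (T 2 ^ α 2) (T 0) := Commute.pow_left (hT 2 0) _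
  have h2 : Commute (T 2 ^ α 2) (T 1) := Commute.pow_left (hT 2 1) _
  have h3 : Commute (T 1 ^ α 1) (T 0) := Commute.pow_left (hT 1 0) _
  fin_cases i
  · simp only [opPow, Finsupp.add_apply, Fin.zero_eta, Finsupp.single_eq_same, pow_succ]
    simp only [mul_assoc, h1.eq]
    simp [← mul_assoc (T 1 ^ α 1), h3.eq, mul_assoc]
  · simp [opPow, pow_succ, mul_assoc, h2.eq]
  · simp [opPow, pow_succ, mul_assoc]

lemma opPow_add_single' {T : Fin 3 → Module.End ℂ M} (hT : ∀ i j, T i * T j = T j * T i)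
    (α : Fin 3 →₀ ℕ) (i : Fin 3) : opPow T (α + Finsupp.single i 1) = T i * opPow T α := by
  rw [opPow_add_single hT]
  have h : ∀ j, Commute (T j) (T i) := fun j => hT j i
  exact ((((h 0).pow_left _).mul_left ((h 1).pow_left _)).mul_left ((h 2).pow_left _)).eq

lemma polyAct_add (X : Fin 3 → Module.End ℂ M) (g h : Poly) :
    polyAct X (g + h) = polyAct X g + polyAct X h := by
  unfold polyAct
  rw [AddMonoidAlgebra.coeff_add]
  exact Finsupp.sum_add_index' (by simp) (by intros; rw [add_smul])

lemma polyAct_monomial (X : Fin 3 → Module.End ℂ M) (β : Fin 3 →₀ ℕ) (c : ℂ) :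
    polyAct X (monomial β c) = c • opPow X β := by
  unfold polyAct
  exact Finsupp.sum_single_index (by simp)

lemma polyAct_C (X : Fin 3 → Module.End ℂ M) (c : ℂ) : polyAct X (C c) = c • 1 := by
  rw [← monomial_zero', polyAct_monomial, opPow_zero]

lemma polyAct_zero (X : Fin 3 → Module.End ℂ M) : polyAct X 0 = 0 := by
  simpa using polyAct_C X 0

lemma polyAct_mul_X {X : Fin 3 → Module.End ℂ M} (hX : ∀ i j, X i * X j = X j * X i)
    (g : Poly) (i : Fin 3) : polyAct X (g * MvPolynomial.X i) = polyAct X g * X i := by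
  induction g using MvPolynomial.induction_on' with
  | monomial u a =>
    rw [MvPolynomial.X, monomial_mul, mul_one, polyAct_monomial, polyAct_monomial,
      opPow_add_single hX, smul_mul_assoc]
  | add a b ha hb => rw [add_mul, polyAct_add, ha, hb, polyAct_add, add_mul]

lemma polyAct_X_mul {X : Fin 3 → Module.End ℂ M} (hX : ∀ i j, X i * X j = X j * X i)
    (g : Poly) (i : Fin 3) : polyAct X (MvPolynomial.X i * g) = X i * polyAct X g := by
  induction g using MvPolynomial.induction_on' with
  | monomial u a =>
    rw [mul_comm, MvPolynomial.X, monomial_mul, mul_one, polyAct_monomial, polyAct_monomial,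
      opPow_add_single' hX, mul_smul_comm]
  | add a b ha hb => rw [mul_add, polyAct_add, ha, hb, polyAct_add, mul_add]

lemma D_mul_polyAct {X D : Fin 3 → Module.End ℂ M} (h : IsWeylRep X D) (g : Poly) (i : Fin 3) :
    D i * polyAct X g = polyAct X g * D i + polyAct X (pderiv i g) := by
  induction g using MvPolynomial.induction_on with
  | C a => simp [polyAct_C, polyAct_zero]
  | add a b ha hb => rw [polyAct_add, mul_add, ha, hb, map_add, polyAct_add, add_mul]; abel
  | mul_X g j hg =>
    rw [polyAct_mul_X h.comm_X, ← mul_assoc, hg, add_mul, mul_assoc, h.D_mul_X, pderiv_mul,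
      polyAct_add, polyAct_mul_X h.comm_X, pderiv_X, mul_add, mul_assoc]
    by_cases hij : i = j
    · subst hij; simp; abel
    · simp [hij, polyAct_zero]

lemma symAct_add (X D : Fin 3 → Module.End ℂ M) (f g : MvPolynomial (Fin 3) Poly) :
    symAct X D (f + g) = symAct X D f + symAct X D g := by
  unfold symAct
  rw [AddMonoidAlgebra.coeff_add]
  exact Finsupp.sum_add_index' (by simp [polyAct_zero]) (by intros; rw [polyAct_add, add_mul])

lemma symAct_monomial (X D : Fin 3 → Module.End ℂ M) (α : Fin 3 →₀ ℕ) (g : Poly) :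
    symAct X D (monomial α g) = polyAct X g * opPow D α := by
  unfold symAct
  exact Finsupp.sum_single_index (by simp [polyAct_zero])

lemma symAct_smul (X D : Fin 3 → Module.End ℂ M) (c : ℂ) (f : MvPolynomial (Fin 3) Poly) :
    symAct X D (c • f) = c • symAct X D f := by
  have hp : ∀ g : Poly, polyAct X (c • g) = c • polyAct X g := fun g => by
    induction g using MvPolynomial.induction_on' with
    | monomial u a => rw [smul_monomial, polyAct_monomial, polyAct_monomial, smul_assoc]
    | add a b ha hb => rw [smul_add, polyAct_add, polyAct_add, ha, hb, smul_add]
  induction f using MvPolynomial.induction_on' with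
  | monomial u a => rw [smul_monomial, symAct_monomial, symAct_monomial, hp, smul_mul_assoc]
  | add a b ha hb => rw [smul_add, symAct_add, symAct_add, ha, hb, smul_add]

lemma symAct_one (X D : Fin 3 → Module.End ℂ M) : symAct X D 1 = 1 := by
  rw [← C_1, ← monomial_zero', symAct_monomial, opPow_zero, ← C_1, polyAct_C]; simp

lemma coeffDeriv_add (i : Fin 3) (f g : MvPolynomial (Fin 3) Poly) :
    coeffDeriv i (f + g) = coeffDeriv i f + coeffDeriv i g := by
  unfold coeffDeriv
  rw [AddMonoidAlgebra.coeff_add]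
  exact Finsupp.sum_add_index' (by simp) (by simp)

lemma coeffDeriv_monomial (i : Fin 3) (α : Fin 3 →₀ ℕ) (g : Poly) :
    coeffDeriv i (monomial α g) = monomial α (pderiv i g) := by
  unfold coeffDeriv
  exact Finsupp.sum_single_index (by simp)

lemma X_mul_symAct {X D : Fin 3 → Module.End ℂ M} (h : IsWeylRep X D)
    (f : MvPolynomial (Fin 3) Poly) (i : Fin 3) :
    X i * symAct X D f = symAct X D (C (MvPolynomial.X i) * f) := by
  induction f using MvPolynomial.induction_on' with
  | monomial α g =>
    rw [C_mul_monomial, symAct_monomial, symAct_monomial, polyAct_X_mul h.comm_X, mul_assoc]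
  | add a b ha hb => rw [symAct_add, mul_add, ha, hb, mul_add, symAct_add]

lemma D_mul_symAct {X D : Fin 3 → Module.End ℂ M} (h : IsWeylRep X D)
    (f : MvPolynomial (Fin 3) Poly) (i : Fin 3) :
    D i * symAct X D f = symAct X D (MvPolynomial.X i * f + coeffDeriv i f) := by
  induction f using MvPolynomial.induction_on' with
  | monomial α g =>
    rw [mul_comm, MvPolynomial.X, monomial_mul, mul_one, coeffDeriv_monomial, symAct_add,
      symAct_monomial, symAct_monomial, symAct_monomial, opPow_add_single' h.comm_D, ← mul_assoc,
      D_mul_polyAct h, add_mul, mul_assoc]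
  | add a b ha hb =>
    rw [symAct_add, mul_add, ha, hb, mul_add, coeffDeriv_add, ← symAct_add]
    congr 1; abel

end Act

lemma mulX_apply (i : Fin 3) (g : Poly) : mulX i g = X i * g := rfl

lemma partialD_apply (i : Fin 3) (g : Poly) : partialD i g = pderiv i g := rfl

lemma isWeylRep_poly : IsWeylRep mulX partialD where
  comm_X i j := LinearMap.ext fun g => by simp [mulX_apply, mul_left_comm]
  comm_D i j := LinearMap.ext fun g => by
    simp only [Module.End.mul_apply, partialD_apply]
    induction g using MvPolynomial.induction_on with
    | C a => simp
    | add a b ha hb => simp only [map_add, ha, hb]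
    | mul_X g k hg =>
      simp only [pderiv_mul, map_add, hg, pderiv_X, Pi.single_apply]
      split_ifs <;> simp <;> ring
  D_mul_X i j := LinearMap.ext fun g => by
    simp only [Module.End.mul_apply, partialD_apply, mulX_apply, LinearMap.add_apply, pderiv_mul,
      pderiv_X]
    by_cases h : i = j
    · subst h; simp [add_comm]
    · simp [h, Ne.symm h]

lemma polyAct_mulX (g : Poly) : polyAct mulX g = LinearMap.mulLeft ℂ g := by
  induction g using MvPolynomial.induction_on with
  | C a => exact LinearMap.ext fun h => by simp [polyAct_C, MvPolynomial.smul_eq_C_mul]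
  | add a b ha hb => rw [polyAct_add, ha, hb]; exact LinearMap.ext fun h => by simp [add_mul]
  | mul_X g j hg =>
    rw [polyAct_mul_X isWeylRep_poly.comm_X, hg]
    exact LinearMap.ext fun h => by simp [mulX_apply]

lemma ofSymbol_eq_symAct (f : MvPolynomial (Fin 3) Poly) : ofSymbol f = symAct mulX partialD f := by
  unfold ofSymbol symAct
  rw [MvPolynomial.sum_def]
  exact Finset.sum_congr rfl fun α _ => by rw [polyAct_mulX, opPow]

lemma partialD_pow_monomial (i : Fin 3) (n : ℕ) (α : Fin 3 →₀ ℕ) (c : ℂ) :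
    (partialD i ^ n) (monomial α c) =
      monomial (α - Finsupp.single i n) (c * (α i).descFactorial n) := by
  induction n with
  | zero => simp
  | succ n ih =>
    rw [pow_succ', Module.End.mul_apply, ih]
    simp only [partialD_apply, pderiv_monomial]
    rw [Nat.descFactorial_succ, tsub_tsub, ← Finsupp.single_add]
    simp only [Finsupp.coe_tsub, Pi.sub_apply, Finsupp.single_eq_same]
    congr 1; push_cast; ring

lemma opPow_partialD_monomial (α β : Fin 3 →₀ ℕ) :
    opPow partialD α (monomial β 1) = monomial (β - α)
      (((β 0).descFactorial (α 0) * (β 1).descFactorial (α 1) * (β 2).descFactorial (α 2) : ℕ) :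
        ℂ) := by
  simp only [opPow, Module.End.mul_apply, partialD_pow_monomial]
  have : β - Finsupp.single 2 (α 2) - Finsupp.single 1 (α 1) - Finsupp.single 0 (α 0) = β - α := by
    ext j; fin_cases j <;> simp
  rw [this]
  congr 1; simp; ring

/-- A differential operator determines its total symbol: the coefficient at a minimal exponent `α`
is recovered by applying the operator to the monomial with exponent `α`. -/
lemma eq_zero_of_ofSymbol_eq_zero {f : MvPolynomial (Fin 3) Poly} (hf : ofSymbol f = 0) :
    f = 0 := by
  by_contra hne
  obtain ⟨α, hα, hmin⟩ := f.support.exists_minimal (support_nonempty.2 hne)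
  have h : ofSymbol f (monomial α 1) = 0 := by rw [hf]; rfl
  rw [ofSymbol_eq_symAct, symAct, MvPolynomial.sum_def, LinearMap.sum_apply] at h
  rw [Finset.sum_eq_single α] at h
  · rw [Module.End.mul_apply, opPow_partialD_monomial, polyAct_mulX] at h
    simp only [tsub_self, monomial_zero', LinearMap.mulLeft_apply, mul_eq_zero,
      Nat.descFactorial_self] at h
    rcases h with h | h
    · exact mem_support_iff.1 hα h
    · rw [map_eq_zero_iff _ (C_injective _ _)] at h
      have := Nat.cast_ne_zero (R := ℂ).2
        (mul_ne_zero (mul_ne_zero (α 0).factorial_ne_zero (α 1).factorial_ne_zero)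
          (α 2).factorial_ne_zero)
      exact this h
  · intro β hβ hne
    rw [Module.End.mul_apply, opPow_partialD_monomial]
    have : ∃ i, α i < β i := by
      by_contra! hle
      exact hne (le_antisymm hle (hmin hβ hle))
    obtain ⟨i, hi⟩ := this
    have h0 : (α 0).descFactorial (β 0) * (α 1).descFactorial (β 1) *
        (α 2).descFactorial (β 2) = 0 := by
      have h0 := Nat.descFactorial_eq_zero_iff_lt.2 hi
      fin_cases i <;> simp only [Fin.zero_eta, Fin.mk_one, Fin.reduceFinMk] at h0 <;> simp [h0]
    rw [h0]
    simp
  · intro h; exact absurd hα h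

lemma ofSymbol_injective : Function.Injective ofSymbol := by
  intro f g h
  rw [← sub_eq_zero]
  apply eq_zero_of_ofSymbol_eq_zero
  have := symAct_add mulX partialD (f - g) g
  rw [sub_add_cancel, ← ofSymbol_eq_symAct, ← ofSymbol_eq_symAct, ← ofSymbol_eq_symAct, h] at this
  simpa using this

section Rep

variable {M : Type*} [AddCommGroup M] [Module ℂ M] {X D : Fin 3 → Module.End ℂ M}

/-- The subalgebra of `End ℂ[p, q, r] × End M` generated by the pairs of corresponding operators; it
is the graph of the representation of the Weyl algebra on `M`. -/
def weylGraph (X D : Fin 3 → Module.End ℂ M) :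
    Subalgebra ℂ (Module.End ℂ Poly × Module.End ℂ M) :=
  Algebra.adjoin ℂ (Set.range (fun i => (mulX i, X i)) ∪ Set.range (fun i => (partialD i, D i)))

/-- The normal form of an operator, simultaneously on polynomials and on `M`. -/
lemma exists_symbol_of_mem_weylGraph (h : IsWeylRep X D) {a : Module.End ℂ Poly × Module.End ℂ M}
    (ha : a ∈ weylGraph X D) :
    ∃ f, a = (ofSymbol f, symAct X D f) := by
  rw [weylGraph, ← Subalgebra.mem_toSubmodule, Algebra.adjoin_eq_span] at ha
  simp only [ofSymbol_eq_symAct]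
  induction ha using Submodule.span_induction with
  | zero => exact ⟨0, Prod.ext (by simp [symAct]) (by simp [symAct])⟩
  | add a b _ _ iha ihb =>
    obtain ⟨f, rfl⟩ := iha
    obtain ⟨g, rfl⟩ := ihb
    exact ⟨f + g, by simp [symAct_add]⟩
  | smul c a _ iha =>
    obtain ⟨f, rfl⟩ := iha
    exact ⟨c • f, by simp [symAct_smul]⟩
  | mem a ha =>
    induction ha using Submonoid.closure_induction_left with
    | one => exact ⟨1, Prod.ext (symAct_one _ _).symm (symAct_one _ _).symm⟩
    | mul_left x hx y _ ih =>
      obtain ⟨f, rfl⟩ := ih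
      rcases hx with ⟨i, rfl⟩ | ⟨i, rfl⟩
      · exact ⟨_, Prod.ext (X_mul_symAct isWeylRep_poly f i) (X_mul_symAct h f i)⟩
      · exact ⟨_, Prod.ext (D_mul_symAct isWeylRep_poly f i) (D_mul_symAct h f i)⟩

lemma fst_weylGraph_injective (h : IsWeylRep X D) :
    Function.Injective ((AlgHom.fst ℂ (Module.End ℂ Poly) (Module.End ℂ M)).comp
      (weylGraph X D).val) := by
  rw [injective_iff_map_eq_zero]
  rintro ⟨a, ha⟩ h0
  obtain ⟨f, rfl⟩ := exists_symbol_of_mem_weylGraph h ha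
  have : f = 0 := eq_zero_of_ofSymbol_eq_zero h0
  subst this
  exact Subtype.ext (Prod.ext h0 (by simp [symAct]))

lemma range_fst_weylGraph : ((AlgHom.fst ℂ (Module.End ℂ Poly) (Module.End ℂ M)).comp
      (weylGraph X D).val).range = Weyl := by
  rw [AlgHom.range_comp, Subalgebra.range_val, weylGraph, AlgHom.map_adjoin, Set.image_union,
    ← Set.range_comp, ← Set.range_comp]
  rfl

/-- The representation of the Weyl algebra on `M` given by operators that satisfy the Weyl
relations. -/
def weylRep (h : IsWeylRep X D) : Weyl →ₐ[ℂ] Module.End ℂ M :=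
  ((AlgHom.snd ℂ (Module.End ℂ Poly) (Module.End ℂ M)).comp (weylGraph X D).val).comp
    ((Subalgebra.equivOfEq _ _ range_fst_weylGraph.symm).trans
      (AlgEquiv.ofInjective _ (fst_weylGraph_injective h)).symm : Weyl →ₐ[ℂ] weylGraph X D)

lemma weylRep_eq (h : IsWeylRep X D) {L : Weyl} {B : Module.End ℂ M}
    (hB : ((L : Module.End ℂ Poly), B) ∈ weylGraph X D) : weylRep h L = B := by
  have : ((Subalgebra.equivOfEq _ _ range_fst_weylGraph.symm).trans
      (AlgEquiv.ofInjective _ (fst_weylGraph_injective h)).symm) L = ⟨_, hB⟩ := by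
    rw [AlgEquiv.trans_apply, AlgEquiv.symm_apply_eq]
    rfl
  exact congrArg (fun a : weylGraph X D => a.1.2) this

lemma weylRep_coord (h : IsWeylRep X D) (i : Fin 3) : weylRep h (coord i) = X i :=
  weylRep_eq h (Algebra.subset_adjoin (Or.inl ⟨i, rfl⟩))

lemma weylRep_del (h : IsWeylRep X D) (i : Fin 3) : weylRep h (del i) = D i :=
  weylRep_eq h (Algebra.subset_adjoin (Or.inr ⟨i, rfl⟩))

lemma weylRep_euler (h : IsWeylRep X D) (i : Fin 3) : weylRep h (euler i) = X i * D i := by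
  rw [euler, map_mul, weylRep_coord, weylRep_del]

lemma exists_weylRep_mem (h : IsWeylRep X D) (L : Weyl) :
    ((L : Module.End ℂ Poly), weylRep h L) ∈ weylGraph X D := by
  have hL : (L : Module.End ℂ Poly) ∈ ((AlgHom.fst ℂ (Module.End ℂ Poly) (Module.End ℂ M)).comp
      (weylGraph X D).val).range := by
    rw [range_fst_weylGraph]; exact L.2
  obtain ⟨⟨⟨a, b⟩, hab⟩, hL⟩ := hL
  have ha : a = L := hL
  subst ha
  rwa [weylRep_eq h hab]

lemma weylRep_of_symbol (h : IsWeylRep X D) {L : Weyl} {f : MvPolynomial (Fin 3) Poly}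
    (hf : ofSymbol f = (L : Module.End ℂ Poly)) : weylRep h L = symAct X D f := by
  obtain ⟨g, hg⟩ := exists_symbol_of_mem_weylGraph h (exists_weylRep_mem h L)
  have h1 : g = f := ofSymbol_injective ((congrArg Prod.fst hg).symm.trans hf.symm)
  rw [← h1]
  exact congrArg Prod.snd hg

/-- If the generators of a left ideal map `w` into a submodule stable under the Weyl algebra, then
so does every operator of the ideal. -/
lemma symAct_mem_of_mem_span (h : IsWeylRep X D) {S : Submodule ℂ M}
    (hX : ∀ i, ∀ c ∈ S, X i c ∈ S) (hD : ∀ i, ∀ c ∈ S, D i c ∈ S) {w : M} {G : Set Weyl}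
    (hG : ∀ L ∈ G, weylRep h L w ∈ S) {L : Weyl} (hL : L ∈ Ideal.span G)
    {f : MvPolynomial (Fin 3) Poly} (hf : ofSymbol f = (L : Module.End ℂ Poly)) :
    symAct X D f w ∈ S := by
  rw [← weylRep_of_symbol h hf]
  have hstable : ∀ (a : Weyl), ∀ c ∈ S, weylRep h a c ∈ S := by
    rintro ⟨a, ha⟩
    induction ha using Algebra.adjoin_induction with
    | mem a ha =>
      rcases ha with ⟨i, rfl⟩ | ⟨i, rfl⟩
      · exact fun c hc => (weylRep_coord h i).symm ▸ hX i c hc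
      · exact fun c hc => (weylRep_del h i).symm ▸ hD i c hc
    | algebraMap z =>
      intro c hc
      have : weylRep h (algebraMap ℂ Weyl z) c = z • c := by rw [AlgHom.commutes]; rfl
      exact this ▸ S.smul_mem z hc
    | add a b ha hb iha ihb =>
      intro c hc
      change weylRep h (⟨a, ha⟩ + ⟨b, hb⟩) c ∈ S
      rw [map_add]
      exact S.add_mem (iha c hc) (ihb c hc)
    | mul a b ha hb iha ihb =>
      intro c hc
      change weylRep h (⟨a, ha⟩ * ⟨b, hb⟩) c ∈ S
      rw [map_mul]
      exact iha _ (ihb c hc)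
  clear hf
  induction hL using Submodule.span_induction with
  | mem L hL => exact hG L hL
  | zero => simp
  | add a b _ _ iha ihb =>
    rw [map_add]
    exact S.add_mem iha ihb
  | smul a b _ ih =>
    rw [smul_eq_mul, map_mul]
    exact hstable _ _ ih

end Rep

end Representations

/-! ### The action of the generators of the Picard–Fuchs ideal -/

section PicardFuchsAction

variable {M : Type*} [AddCommGroup M] [Module ℂ M] {X D : Fin 3 → Module.End ℂ M}

lemma weylRep_sub (h : IsWeylRep X D) (K L : Weyl) :
    weylRep h (K - L) = weylRep h K - weylRep h L := map_sub (weylRep h) K L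

lemma weylRep_one (h : IsWeylRep X D) : weylRep h (1 : Weyl) = 1 := map_one (weylRep h)

lemma weylRep_add (h : IsWeylRep X D) (K L : Weyl) :
    weylRep h (K + L) = weylRep h K + weylRep h L := map_add (weylRep h) K L

lemma weylRep_mul_apply (h : IsWeylRep X D) (K L : Weyl) (w : M) :
    weylRep h (K * L) w = weylRep h K (weylRep h L w) :=
  LinearMap.congr_fun (map_mul (weylRep h) K L) w

lemma weylRep_natCast_apply (h : IsWeylRep X D) (n : ℕ) (w : M) :
    weylRep h (n : Weyl) w = (n : ℂ) • w := by
  rw [map_natCast, Module.End.natCast_apply, Nat.cast_smul_eq_nsmul]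

lemma weylRep_algebraMap_apply (h : IsWeylRep X D) (c : ℂ) (w : M) :
    weylRep h (algebraMap ℂ Weyl c) w = c • w :=
  LinearMap.congr_fun ((weylRep h).commutes c) w

lemma weylRep_ofNat_apply (h : IsWeylRep X D) (w : M) :
    weylRep h (2 : Weyl) w = (2 : ℂ) • w ∧ weylRep h (3 : Weyl) w = (3 : ℂ) • w ∧
      weylRep h (4 : Weyl) w = (4 : ℂ) • w ∧ weylRep h (6 : Weyl) w = (6 : ℂ) • w ∧
      weylRep h (9 : Weyl) w = (9 : ℂ) • w ∧ weylRep h (16 : Weyl) w = (16 : ℂ) • w ∧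
      weylRep h (30 : Weyl) w = (30 : ℂ) • w :=
  ⟨weylRep_natCast_apply h 2 w, weylRep_natCast_apply h 3 w, weylRep_natCast_apply h 4 w,
    weylRep_natCast_apply h 6 w, weylRep_natCast_apply h 9 w, weylRep_natCast_apply h 16 w,
    weylRep_natCast_apply h 30 w⟩

lemma weylRep_gkz1_apply (h : IsWeylRep X D) (w : M) : weylRep h gkz1 w =
    X 1 (X 1 (X 0 (D 0 (X 2 (D 2 w))))) - X 0 (X 2 (X 1 (D 1 (X 1 (D 1 w) - w)))) := by
  unfold gkz1
  simp only [weylRep_sub, weylRep_mul_apply, weylRep_euler, weylRep_coord, weylRep_one, pow_two,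
    LinearMap.sub_apply, Module.End.mul_apply, Module.End.one_apply]

lemma weylRep_gkz2_apply (h : IsWeylRep X D) (w : M) : weylRep h gkz2 w =
    X 0 (X 0 (X 1 (D 1 (X 1 (D 1 w) + (2 : ℂ) • X 2 (D 2 w))))) -
      X 1 (X 0 (D 0 (X 0 (D 0 w) - w))) := by
  unfold gkz2
  simp only [weylRep_sub, weylRep_add, weylRep_mul_apply, weylRep_euler, weylRep_coord,
    weylRep_one, pow_two, LinearMap.sub_apply, LinearMap.add_apply, Module.End.mul_apply,
    Module.End.one_apply, weylRep_ofNat_apply]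

lemma weylRep_gkz3_apply (h : IsWeylRep X D) (w : M) : weylRep h gkz3 w =
    X 0 (D 0 (X 0 (D 0 w) + (2 : ℂ) • X 1 (D 1 w) + (3 : ℂ) • X 2 (D 2 w))) -
      X 0 (X 0 (D 0 (X 0 (D 0 w) + (2 : ℂ) • X 1 (D 1 w) + (3 : ℂ) • X 2 (D 2 w)
            + (1 / 2 : ℂ) • w))
        + (2 : ℂ) • X 1 (D 1 (X 0 (D 0 w) + (2 : ℂ) • X 1 (D 1 w) + (3 : ℂ) • X 2 (D 2 w)
            + (1 / 2 : ℂ) • w))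
        + (3 : ℂ) • X 2 (D 2 (X 0 (D 0 w) + (2 : ℂ) • X 1 (D 1 w) + (3 : ℂ) • X 2 (D 2 w)
            + (1 / 2 : ℂ) • w))
        + (1 / 2 : ℂ) • (X 0 (D 0 w) + (2 : ℂ) • X 1 (D 1 w) + (3 : ℂ) • X 2 (D 2 w)
            + (1 / 2 : ℂ) • w)) := by
  unfold gkz3
  simp only [weylRep_sub, weylRep_add, weylRep_mul_apply, weylRep_euler, weylRep_coord, pow_two,
    LinearMap.sub_apply, LinearMap.add_apply, Module.End.mul_apply, weylRep_ofNat_apply,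
    weylRep_algebraMap_apply]

lemma weylRep_gkz4_apply (h : IsWeylRep X D) (w : M) : weylRep h gkz4 w =
    X 0 (X 1 (X 2 (D 2 (X 1 (D 1 w) + (2 : ℂ) • X 2 (D 2 w))))) -
      X 2 (X 0 (D 0 (X 1 (D 1 w)))) := by
  unfold gkz4
  simp only [weylRep_sub, weylRep_add, weylRep_mul_apply, weylRep_euler, weylRep_coord,
    LinearMap.sub_apply, LinearMap.add_apply, Module.End.mul_apply, weylRep_ofNat_apply]

lemma weylRep_newEq_apply (h : IsWeylRep X D) (w : M) : weylRep h newEq w =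
    (9 : ℂ) • X 1 (X 2 (X 0 (D 0 (w + (2 : ℂ) • X 2 (D 2 w)))))
      - (4 : ℂ) • X 0 (X 2 (X 1 (D 1 ((2 : ℂ) • X 1 (D 1 w) + (3 : ℂ) • X 2 (D 2 w)))))
      - (4 : ℂ) • X 0 (X 0 (X 1 (X 2 (D 2 (X 1 (D 1 w) + (2 : ℂ) • X 2 (D 2 w))))))
      + (4 : ℂ) • X 0 (X 0 (X 2 (X 1 (D 1
          (X 0 (D 0 w) + (4 : ℂ) • X 1 (D 1 w) + (6 : ℂ) • X 2 (D 2 w))))))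
      + X 0 (X 1 (X 1 (X 2 (D 2
          (w + (16 : ℂ) • X 1 (D 1 w) + (30 : ℂ) • X 2 (D 2 w)))))) := by
  unfold newEq
  simp only [weylRep_sub, weylRep_add, weylRep_mul_apply, weylRep_euler, weylRep_coord, pow_two,
    weylRep_one, LinearMap.sub_apply, LinearMap.add_apply, Module.End.mul_apply,
    weylRep_ofNat_apply, Module.End.one_apply]

end PicardFuchsAction

/-! ### Distributions supported along a hypersurface, over a torus ring -/

/-- The coordinate ring `ℂ[q^±¹, r^±¹, t^±¹]` of a torus; the coordinates `0, 1, 2` are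
`q, r, t`. -/
abbrev Torus : Type := AddMonoidAlgebra ℂ (Fin 3 → ℤ)

namespace Torus

/-- The logarithmic derivation `x ∂/∂x` for the `i`-th coordinate `x` of the torus. -/
def dlog (i : Fin 3) : Derivation ℂ Torus Torus :=
  Derivation.mk'
    { toFun := fun f => (AddMonoidAlgebra.coeff f).sum
        fun v c => AddMonoidAlgebra.single v ((v i : ℂ) * c)
      map_add' := fun f g => by
        rw [AddMonoidAlgebra.coeff_add]
        exact Finsupp.sum_add_index' (by simp)
          (fun v a b => by rw [mul_add, AddMonoidAlgebra.single_add])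
      map_smul' := fun c f => by
        rw [AddMonoidAlgebra.coeff_smul, Finsupp.sum_smul_index' (by simp), Finsupp.smul_sum]
        refine Finset.sum_congr rfl fun v _ => ?_
        change AddMonoidAlgebra.single v ((v i : ℂ) * c • AddMonoidAlgebra.coeff f v) =
          c • AddMonoidAlgebra.single v ((v i : ℂ) * AddMonoidAlgebra.coeff f v)
        rw [AddMonoidAlgebra.smul_single, smul_eq_mul, smul_eq_mul, mul_left_comm] }
    (by
      have hs : ∀ v c, (AddMonoidAlgebra.coeff (AddMonoidAlgebra.single v c : Torus)).sum
        (fun v c => (AddMonoidAlgebra.single v ((v i : ℂ) * c) : Torus)) =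
          AddMonoidAlgebra.single v ((v i : ℂ) * c) := fun v c => Finsupp.sum_single_index (by simp)
      intro f g
      induction f using AddMonoidAlgebra.induction_linear with
      | zero => simp
      | add f₁ f₂ h₁ h₂ => rw [add_mul, map_add, h₁, h₂, map_add, add_smul, smul_add]; abel
      | single v a =>
        induction g using AddMonoidAlgebra.induction_linear with
        | zero => simp
        | add f₁ f₂ h₁ h₂ => rw [mul_add, map_add, h₁, h₂, map_add, add_smul, smul_add]; abel
        | single w b =>
          simp only [LinearMap.coe_mk, AddHom.coe_mk, smul_eq_mul,
            AddMonoidAlgebra.single_mul_single, hs]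
          rw [add_comm w v, ← AddMonoidAlgebra.single_add, Pi.add_apply]
          congr 1
          push_cast
          ring)

lemma dlog_single (i : Fin 3) (v : Fin 3 → ℤ) (c : ℂ) :
    dlog i (AddMonoidAlgebra.single v c) = AddMonoidAlgebra.single v ((v i : ℂ) * c) := by
  change (AddMonoidAlgebra.coeff (AddMonoidAlgebra.single v c : Torus)).sum
        (fun v c => (AddMonoidAlgebra.single v ((v i : ℂ) * c) : Torus)) = _
  exact Finsupp.sum_single_index (by simp)

/-- The coordinates of the torus. -/
def var (i : Fin 3) : Torus := AddMonoidAlgebra.single (Pi.single i 1) 1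

/-- The inverses of the coordinates of the torus. -/
def inv (i : Fin 3) : Torus := AddMonoidAlgebra.single (Pi.single i (-1)) 1

lemma var_mul_inv (i : Fin 3) : var i * inv i = 1 := by
  rw [var, inv, AddMonoidAlgebra.single_mul_single, ← Pi.single_add]
  simp [AddMonoidAlgebra.one_def]

lemma dlog_var (i j : Fin 3) : dlog i (var j) = if i = j then var j else 0 := by
  rw [var, dlog_single]
  by_cases h : i = j
  · subst h; simp
  · simp [h]

lemma dlog_inv (i j : Fin 3) : dlog i (inv j) = if i = j then -inv j else 0 := by
  rw [inv, dlog_single]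
  by_cases h : i = j
  · subst h; simp
  · simp [h]

lemma dlog_comm (i j : Fin 3) (f : Torus) : dlog i (dlog j f) = dlog j (dlog i f) := by
  induction f using AddMonoidAlgebra.induction_linear with
  | zero => simp
  | add f₁ f₂ h₁ h₂ => simp only [map_add, h₁, h₂]
  | single v a => simp only [dlog_single, mul_left_comm]

/-- The partial derivative in the `i`-th coordinate of the torus. -/
def pd (i : Fin 3) : Derivation ℂ Torus Torus := inv i • dlog i

lemma pd_var (i j : Fin 3) : pd i (var j) = if i = j then 1 else 0 := by
  rw [pd, Derivation.smul_apply, dlog_var]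
  by_cases h : i = j
  · subst h; rw [if_pos rfl, if_pos rfl, smul_eq_mul, mul_comm, var_mul_inv]
  · simp [h]

lemma pd_inv_of_ne {i j : Fin 3} (h : i ≠ j) : pd i (inv j) = 0 := by
  rw [pd, Derivation.smul_apply, dlog_inv, if_neg h, smul_zero]

lemma pd_comm (i j : Fin 3) (f : Torus) : pd i (pd j f) = pd j (pd i f) := by
  by_cases h : i = j
  · rw [h]
  · nth_rw 2 [pd]
    nth_rw 3 [pd]
    rw [Derivation.smul_apply, Derivation.smul_apply, smul_eq_mul, smul_eq_mul,
      Derivation.leibniz, Derivation.leibniz, pd_inv_of_ne h, pd_inv_of_ne (Ne.symm h),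
      pd, pd]
    simp only [Derivation.smul_apply, smul_eq_mul, dlog_comm i j]
    ring

/-- Evaluation at a point of the torus. -/
def eval (x : Fin 3 → ℂˣ) : Torus →ₐ[ℂ] ℂ :=
  AddMonoidAlgebra.lift ℂ ℂ (Fin 3 → ℤ)
    { toFun := fun v => ((∏ i, x i ^ (v.toAdd i) : ℂˣ) : ℂ)
      map_one' := by simp
      map_mul' := fun v w => by simp [zpow_add, Finset.prod_mul_distrib] }

lemma eval_var (x : Fin 3 → ℂˣ) (i : Fin 3) : eval x (var i) = x i := by
  simp only [eval, var, AddMonoidAlgebra.lift_single]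
  fin_cases i <;> simp [Fin.prod_univ_three]

lemma eval_inv (x : Fin 3 → ℂˣ) (i : Fin 3) : eval x (inv i) = (x i : ℂ)⁻¹ := by
  simp only [eval, inv, AddMonoidAlgebra.lift_single]
  fin_cases i <;> simp [Fin.prod_univ_three]

end Torus

section Operators

open Torus

/-- Multiplication by `y` on formal sums `∑ c_k e_k`, `k ∈ ℤ`, with coefficients in the torus ring.
The basis distribution `e_k` is the divided power `y ^ k / k!`, cut off at `y = 0`, for `k ≥ 0`, and
a derivative of the delta distribution for `k < 0`; thus `y e_k = (k + 1) e_{k+1}` for all `k`. -/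
def yMul : Module.End ℂ (ℤ → Torus) where
  toFun c k := (k : ℂ) • c (k - 1)
  map_add' c d := by ext1 k; simp
  map_smul' a c := by ext1 k; simp [smul_comm a]

/-- The derivative `∂/∂y` on formal sums of basis distributions: `∂ e_k = e_{k-1}`. -/
def yDeriv : Module.End ℂ (ℤ → Torus) where
  toFun c k := c (k + 1)
  map_add' _ _ := rfl
  map_smul' _ _ := rfl

/-- A derivation of the torus ring, acting on the coefficients. -/
def onCoeff (d : Derivation ℂ Torus Torus) : Module.End ℂ (ℤ → Torus) where
  toFun c k := d (c k)
  map_add' c d := by ext1 k; simp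
  map_smul' a c := by ext1 k; simp

/-- Multiplication by an element of the torus ring. -/
def scal (a : Torus) : Module.End ℂ (ℤ → Torus) where
  toFun c := a • c
  map_add' c d := smul_add a c d
  map_smul' b c := (smul_comm a b c)

lemma yMul_apply (c : ℤ → Torus) (k : ℤ) : yMul c k = (k : ℂ) • c (k - 1) := rfl
lemma yDeriv_apply (c : ℤ → Torus) (k : ℤ) : yDeriv c k = c (k + 1) := rfl
lemma onCoeff_apply (d : Derivation ℂ Torus Torus) (c : ℤ → Torus) (k : ℤ) :
    onCoeff d c k = d (c k) := rfl

/-- `z - p = t + q / t + r / t²`. -/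
def zRest : Torus := var 2 + var 0 * inv 2 + var 1 * inv 2 ^ 2

/-- `t ∂z/∂t = t - q / t - 2 r / t²`. -/
def zDot : Torus := var 2 - var 0 * inv 2 - 2 * var 1 * inv 2 ^ 2

/-- The coordinates `p = y + ε - (t + q / t + r / t²)`, `q`, `r`. -/
def coordOp (ε : ℂ) : Fin 3 → Module.End ℂ (ℤ → Torus) :=
  ![yMul + scal (algebraMap ℂ Torus ε - zRest), scal (var 0), scal (var 1)]

/-- The derivatives `∂_p, ∂_q, ∂_r` at fixed `t`, in the coordinates `y, q, r, t`. -/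
def derivOp : Fin 3 → Module.End ℂ (ℤ → Torus) :=
  ![yDeriv, onCoeff (pd 0) + scal (inv 2) * yDeriv,
    onCoeff (pd 1) + scal (inv 2 ^ 2) * yDeriv]

/-- The derivative `t ∂/∂t` at fixed `p, q, r`, in the coordinates `y, q, r, t`. -/
def tEuler : Module.End ℂ (ℤ → Torus) := onCoeff (dlog 2) + scal zDot * yDeriv

lemma yDeriv_yMul (c : ℤ → Torus) : yDeriv (yMul c) = yMul (yDeriv c) + c := by
  ext1 k
  simp only [Pi.add_apply, yDeriv_apply, yMul_apply, add_sub_cancel_right, sub_add_cancel,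
    Int.cast_add, Int.cast_one, add_smul, one_smul]

lemma yMul_smul (a : Torus) (c : ℤ → Torus) : yMul (a • c) = a • yMul c := by
  ext1 k; simp [yMul_apply]

lemma yDeriv_smul (a : Torus) (c : ℤ → Torus) : yDeriv (a • c) = a • yDeriv c := by
  ext1 k; simp [yDeriv_apply]

lemma onCoeff_smul (d : Derivation ℂ Torus Torus) (a : Torus) (c : ℤ → Torus) :
    onCoeff d (a • c) = d a • c + a • onCoeff d c := by
  ext1 k; simp [onCoeff_apply, Derivation.leibniz]; ring

lemma onCoeff_yMul (d : Derivation ℂ Torus Torus) (c : ℤ → Torus) :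
    onCoeff d (yMul c) = yMul (onCoeff d c) := by
  ext1 k; simp [onCoeff_apply, yMul_apply]

lemma onCoeff_yDeriv (d : Derivation ℂ Torus Torus) (c : ℤ → Torus) :
    onCoeff d (yDeriv c) = yDeriv (onCoeff d c) := by
  ext1 k; simp [onCoeff_apply, yDeriv_apply]

lemma onCoeff_pd_comm (i j : Fin 3) (c : ℤ → Torus) :
    onCoeff (pd i) (onCoeff (pd j) c) = onCoeff (pd j) (onCoeff (pd i) c) := by
  ext1 k; simp [onCoeff_apply, pd_comm i j]

lemma onCoeff_pd_dlog_comm {i j : Fin 3} (h : i ≠ j) (c : ℤ → Torus) :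
    onCoeff (dlog j) (onCoeff (pd i) c) = onCoeff (pd i) (onCoeff (dlog j) c) := by
  ext1 k; simp [onCoeff_apply, pd, Derivation.leibniz, dlog_inv, h.symm, dlog_comm i j]

lemma coordOp_zero (ε : ℂ) (c : ℤ → Torus) :
    coordOp ε 0 c = yMul c + (algebraMap ℂ Torus ε - zRest) • c := rfl
lemma coordOp_one (ε : ℂ) (c : ℤ → Torus) : coordOp ε 1 c = var 0 • c := rfl
lemma coordOp_two (ε : ℂ) (c : ℤ → Torus) : coordOp ε 2 c = var 1 • c := rfl
lemma derivOp_zero (c : ℤ → Torus) : derivOp 0 c = yDeriv c := rfl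
lemma derivOp_one (c : ℤ → Torus) :
    derivOp 1 c = onCoeff (pd 0) c + inv 2 • yDeriv c := rfl
lemma derivOp_two (c : ℤ → Torus) :
    derivOp 2 c = onCoeff (pd 1) c + inv 2 ^ 2 • yDeriv c := rfl
lemma tEuler_apply (c : ℤ → Torus) : tEuler c = onCoeff (dlog 2) c + zDot • yDeriv c := rfl

lemma pd_zRest_zero (ε : ℂ) : pd 0 (algebraMap ℂ Torus ε - zRest) = -inv 2 := by
  rw [map_sub, Derivation.map_algebraMap]
  simp [zRest, Derivation.leibniz, Derivation.leibniz_pow, pd_var, pd_inv_of_ne]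

lemma pd_zRest_one (ε : ℂ) : pd 1 (algebraMap ℂ Torus ε - zRest) = -inv 2 ^ 2 := by
  rw [map_sub, Derivation.map_algebraMap]
  simp [zRest, Derivation.leibniz, Derivation.leibniz_pow, pd_var, pd_inv_of_ne]

lemma dlog_zRest (ε : ℂ) : dlog 2 (algebraMap ℂ Torus ε - zRest) = -zDot := by
  rw [map_sub, Derivation.map_algebraMap]
  simp [zRest, zDot, Derivation.leibniz, Derivation.leibniz_pow, dlog_var, dlog_inv]; ring

lemma derivation_two (d : Derivation ℂ Torus Torus) : d 2 = 0 := d.map_natCast 2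

lemma pd_zDot_zero : pd 0 zDot = -inv 2 := by
  simp [zDot, Derivation.leibniz, Derivation.leibniz_pow, pd_var, pd_inv_of_ne, derivation_two]

lemma pd_zDot_one : pd 1 zDot = -2 * inv 2 ^ 2 := by
  simp [zDot, Derivation.leibniz, Derivation.leibniz_pow, pd_var, pd_inv_of_ne, derivation_two]
  ring

lemma isWeylRep_torus (ε : ℂ) : IsWeylRep (coordOp ε) derivOp where
  comm_X i j := LinearMap.ext fun c => by
    fin_cases i <;> fin_cases j <;>
      simp [coordOp_zero, coordOp_one, coordOp_two, yMul_smul, smul_smul, mul_comm]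
  comm_D i j := LinearMap.ext fun c => by
    fin_cases i <;> fin_cases j <;>
      simp [derivOp_zero, derivOp_one, derivOp_two, yDeriv_smul, onCoeff_smul, onCoeff_yDeriv,
        onCoeff_pd_comm 0 1, Derivation.leibniz_pow, pd_inv_of_ne] <;> module
  D_mul_X i j := LinearMap.ext fun c => by
    fin_cases i <;> fin_cases j <;>
      simp [-map_sub, -AddMonoidAlgebra.coe_algebraMap, derivOp_zero, derivOp_one, derivOp_two,
        coordOp_zero, coordOp_one, coordOp_two,
        yDeriv_smul, yDeriv_yMul, yMul_smul, onCoeff_yMul, onCoeff_smul, pd_var,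
        pd_zRest_zero, pd_zRest_one] <;> module

lemma tEuler_coordOp (ε : ℂ) (i : Fin 3) (c : ℤ → Torus) :
    tEuler (coordOp ε i c) = coordOp ε i (tEuler c) := by
  fin_cases i <;>
    simp [-map_sub, -AddMonoidAlgebra.coe_algebraMap, tEuler_apply, coordOp_zero, coordOp_one,
      coordOp_two, yDeriv_smul, yDeriv_yMul, yMul_smul, onCoeff_yMul, onCoeff_smul, dlog_zRest,
      dlog_var] <;> module

lemma tEuler_derivOp (i : Fin 3) (c : ℤ → Torus) :
    tEuler (derivOp i c) = derivOp i (tEuler c) := by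
  fin_cases i <;>
    simp [tEuler_apply, derivOp_zero, derivOp_one, derivOp_two, yDeriv_smul, onCoeff_yDeriv,
      onCoeff_smul, onCoeff_pd_dlog_comm, pd_zDot_zero, pd_zDot_one, dlog_inv,
      Derivation.leibniz_pow] <;> module

end Operators

/-! ### The cut-off period and its differential equations modulo derivatives in `t` -/

section Period

open Torus

/-- The coefficients, with respect to the divided powers `y^k / k!`, of the solution
`∑ ((1/2)_k / k!)² (κ y)^k` of the hypergeometric equation. -/
def hyperCoeff (κ : ℂ) (n : ℕ) : ℂ :=
  κ ^ n * ∏ j ∈ Finset.range n, (((j : ℂ) + 1 / 2) ^ 2 / (j + 1))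

/-- The `n`-th derivative of the elliptic period `F(κ y)` cut off at `y = 0`, where
`F = ∑ ((1/2)_k / k!)² y^k`. With `κ = 1 - 2ε` and `y = z - ε` it is `F(z)` for `ε = 0` and
`F(1 - z)` for `ε = 1`, which solve the same hypergeometric equation. -/
def period (κ : ℂ) (n : ℕ) : ℤ → Torus :=
  (yDeriv ^ n) fun k => if 0 ≤ k then algebraMap ℂ Torus (hyperCoeff κ k.toNat) else 0

lemma period_zero_apply (κ : ℂ) (k : ℤ) : period κ 0 k =
    if 0 ≤ k then algebraMap ℂ Torus (hyperCoeff κ k.toNat) else 0 := rfl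

lemma yDeriv_period (κ : ℂ) (n : ℕ) : yDeriv (period κ n) = period κ (n + 1) := by
  rw [period, period, pow_succ']; rfl

lemma onCoeff_period (d : Derivation ℂ Torus Torus) (κ : ℂ) (n : ℕ) :
    onCoeff d (period κ n) = 0 := by
  induction n with
  | zero =>
    ext1 k
    rw [onCoeff_apply, period_zero_apply]
    split_ifs
    · rw [Derivation.map_algebraMap]; rfl
    · rw [map_zero]; rfl
  | succ n ih => rw [← yDeriv_period, onCoeff_yDeriv, ih, map_zero]

lemma yMul_yDeriv_apply (c : ℤ → Torus) (k : ℤ) : yMul (yDeriv c) k = (k : ℂ) • c k := by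
  rw [yMul_apply, yDeriv_apply, sub_add_cancel]

lemma hyperCoeff_succ (κ : ℂ) (n : ℕ) :
    ((n : ℂ) + 1) * hyperCoeff κ (n + 1) = κ * (n + 1 / 2) ^ 2 * hyperCoeff κ n := by
  have : (n : ℂ) + 1 ≠ 0 := Nat.cast_add_one_ne_zero n
  rw [hyperCoeff, hyperCoeff, Finset.prod_range_succ, pow_succ κ]
  generalize ∏ j ∈ Finset.range n, (((j : ℂ) + 1 / 2) ^ 2 / (j + 1)) = a
  field_simp

lemma period_recurrence (κ : ℂ) (k : ℤ) :
    (k + 1 : ℂ) • period κ 0 (k + 1) = (κ * (k + 1 / 2 : ℂ) ^ 2) • period κ 0 k := by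
  rw [period_zero_apply, period_zero_apply]
  rcases lt_trichotomy k (-1) with h | rfl | h
  · rw [if_neg (by lia), if_neg (by lia), smul_zero, smul_zero]
  · simp
  · lift k to ℕ using by lia
    rw [if_pos (by lia), if_pos (by lia), Algebra.algebraMap_eq_smul_one,
      Algebra.algebraMap_eq_smul_one, smul_smul, smul_smul, Int.toNat_natCast,
      show ((k : ℤ) + 1).toNat = k + 1 from rfl, Int.cast_natCast, hyperCoeff_succ κ k]

/-- The constant `1/2` of the torus ring. -/
def half : Torus := algebraMap ℂ Torus (1 / 2)

lemma two_mul_half : 2 * half = 1 := by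
  rw [half, ← map_ofNat (algebraMap ℂ Torus) 2, ← map_mul, ← map_one (algebraMap ℂ Torus)]
  norm_num

lemma derivation_half (d : Derivation ℂ Torus Torus) : d half = 0 := d.map_algebraMap _

lemma derivation_ofNat (d : Derivation ℂ Torus Torus) : d 3 = 0 ∧ d 4 = 0 ∧ d 6 = 0 ∧ d 8 = 0 ∧
    d 12 = 0 ∧ d 16 = 0 ∧ d 30 = 0 :=
  ⟨d.map_natCast 3, d.map_natCast 4, d.map_natCast 6, d.map_natCast 8, d.map_natCast 12,
    d.map_natCast 16, d.map_natCast 30⟩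

lemma complex_smul (c : ℤ → Torus) :
    (2 : ℂ) • c = (2 : Torus) • c ∧ (3 : ℂ) • c = (3 : Torus) • c ∧
    (4 : ℂ) • c = (4 : Torus) • c ∧ (6 : ℂ) • c = (6 : Torus) • c ∧
    (9 : ℂ) • c = (9 : Torus) • c ∧ (16 : ℂ) • c = (16 : Torus) • c ∧
    (30 : ℂ) • c = (30 : Torus) • c ∧
    (1 / 2 : ℂ) • c = half • c := by
  refine ⟨?_, ?_, ?_, ?_, ?_, ?_, ?_, ?_⟩ <;>
    rw [← algebraMap_smul Torus _ c] <;> simp only [map_ofNat, half]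

/-- The hypergeometric equation `(θ + 1) ∂ F = κ (θ + 1/2)² F`, `θ = y ∂/∂y`. It survives the
cut-off because the only delta distribution that arises is the one in `∂ F`, a multiple of `e₋₁`,
which `θ + 1` kills. -/
lemma hypergeometric_y (κ : ℂ) : yMul (period κ 2) + period κ 1 =
    κ • (yMul (yMul (period κ 2)) + (2 : ℂ) • yMul (period κ 1) + (1 / 4 : ℂ) • period κ 0) := by
  have h1 : yMul (period κ 2) = yDeriv (yMul (period κ 1)) - period κ 1 := by
    rw [yDeriv_yMul, yDeriv_period, add_sub_cancel_right]
  rw [h1, map_sub, ← yDeriv_period κ 0]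
  ext1 k
  have := period_recurrence κ k
  simp only [Pi.add_apply, Pi.sub_apply, Pi.smul_apply, yMul_yDeriv_apply, yDeriv_apply]
  simp only [smul_smul] at this ⊢
  push_cast
  linear_combination (norm := module) this

variable {ε : ℂ}

/-- The hypergeometric equation `z (1 - z) F'' + (1 - 2 z) F' - F / 4 = 0`, with `z` written as the
sum of the operator `p` and of `zRest`. -/
lemma hypergeometric_z (hε : ε = 0 ∨ ε = 1) :
    coordOp ε 0 (period (1 - 2 * ε) 2) + zRest • period (1 - 2 * ε) 2
      - coordOp ε 0 (coordOp ε 0 (period (1 - 2 * ε) 2))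
      - (2 * zRest) • coordOp ε 0 (period (1 - 2 * ε) 2) - zRest ^ 2 • period (1 - 2 * ε) 2
      + period (1 - 2 * ε) 1 - (2 : Torus) • coordOp ε 0 (period (1 - 2 * ε) 1)
      - (2 * zRest) • period (1 - 2 * ε) 1
      - half ^ 2 • period (1 - 2 * ε) 0 = 0 := by
  have h := hypergeometric_y (1 - 2 * ε)
  have h4 : half ^ 2 • period (1 - 2 * ε) 0 =
      (1 / 4 : ℂ) • period (1 - 2 * ε) 0 := by
    rw [half, ← map_pow, algebraMap_smul]; norm_num
  rw [h4]
  rcases hε with rfl | rfl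
  · simp only [coordOp_zero, map_add, map_zero, yMul_smul, smul_add, mul_zero, sub_zero,
      complex_smul] at h ⊢
    linear_combination (norm := module) h
  · rw [show (1 - 2 * 1 : ℂ) = -1 by norm_num] at h ⊢
    simp only [coordOp_zero, map_add, map_one, yMul_smul, smul_add, complex_smul] at h ⊢
    linear_combination (norm := module) -h

lemma coordOp_zero_smul (a : Torus) (c : ℤ → Torus) : coordOp ε 0 (a • c) = a • coordOp ε 0 c := by
  rw [coordOp_zero, coordOp_zero, yMul_smul, smul_add, smul_comm]

lemma derivOp_zero_smul (a : Torus) (c : ℤ → Torus) : derivOp 0 (a • c) = a • derivOp 0 c :=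
  yDeriv_smul a c

lemma derivOp_one_smul (a : Torus) (c : ℤ → Torus) :
    derivOp 1 (a • c) = pd 0 a • c + a • derivOp 1 c := by
  rw [derivOp_one, derivOp_one, onCoeff_smul, yDeriv_smul]; module

lemma derivOp_two_smul (a : Torus) (c : ℤ → Torus) :
    derivOp 2 (a • c) = pd 1 a • c + a • derivOp 2 c := by
  rw [derivOp_two, derivOp_two, onCoeff_smul, yDeriv_smul]; module

lemma tEuler_smul (a : Torus) (c : ℤ → Torus) :
    tEuler (a • c) = dlog 2 a • c + a • tEuler c := by
  rw [tEuler_apply, tEuler_apply, onCoeff_smul, yDeriv_smul]; module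

lemma derivOp_coordOp (i : Fin 3) (c : ℤ → Torus) :
    derivOp i (coordOp ε 0 c) = coordOp ε 0 (derivOp i c) + if i = 0 then c else 0 := by
  have := LinearMap.congr_fun ((isWeylRep_torus ε).D_mul_X i 0) c
  simp only [Module.End.mul_apply, LinearMap.add_apply] at this
  rw [this]; split_ifs <;> rfl

lemma derivOp_zero_period (κ : ℂ) (n : ℕ) : derivOp 0 (period κ n) = period κ (n + 1) :=
  yDeriv_period κ n

lemma derivOp_one_period (κ : ℂ) (n : ℕ) :
    derivOp 1 (period κ n) = inv 2 • period κ (n + 1) := by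
  rw [derivOp_one, onCoeff_period, yDeriv_period, zero_add]

lemma derivOp_two_period (κ : ℂ) (n : ℕ) :
    derivOp 2 (period κ n) = inv 2 ^ 2 • period κ (n + 1) := by
  rw [derivOp_two, onCoeff_period, yDeriv_period, zero_add]

lemma tEuler_period (κ : ℂ) (n : ℕ) : tEuler (period κ n) = zDot • period κ (n + 1) := by
  rw [tEuler_apply, onCoeff_period, yDeriv_period, zero_add]

lemma pd_zero_inv : pd 0 (inv 2) = 0 := pd_inv_of_ne (by decide)

lemma pd_one_inv : pd 1 (inv 2) = 0 := pd_inv_of_ne (by decide)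

lemma gkz1_period : weylRep (isWeylRep_torus ε) gkz1 (period (1 - 2 * ε) 0) = 0 := by
  simp only [weylRep_gkz1_apply, coordOp_one, coordOp_two, coordOp_zero_smul, derivOp_one_smul,
    derivOp_zero_period, derivOp_zero_smul, derivOp_one_period, derivOp_two_period, pd_var,
    pd_zero_inv, map_add, map_sub]
  simp
  module

lemma gkz2_period : weylRep (isWeylRep_torus ε) gkz2 (period (1 - 2 * ε) 0) =
    tEuler (-((var 0 * inv 2) • coordOp ε 0 (coordOp ε 0 (period (1 - 2 * ε) 1)))) := by
  simp only [weylRep_gkz2_apply, coordOp_one, coordOp_two, coordOp_zero_smul, complex_smul,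
    derivOp_one_smul, derivOp_coordOp, derivOp_zero_period, Derivation.leibniz_pow,
    derivOp_one_period, derivOp_two_period, pd_var, pd_zero_inv, map_sub, map_add,
    smul_add, tEuler_smul, tEuler_coordOp, derivation_two,
    tEuler_period, Derivation.leibniz, dlog_var, dlog_inv, map_neg]
  simp
  rw [zDot]
  have h := var_mul_inv 2
  linear_combination (norm := module) (var 0 * h) • coordOp ε 0 (coordOp ε 0 (period (1 - 2 * ε) 2))

lemma gkz3_period (hε : ε = 0 ∨ ε = 1) :
    weylRep (isWeylRep_torus ε) gkz3 (period (1 - 2 * ε) 0) =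
    tEuler (coordOp ε 0 (period (1 - 2 * ε) 0 - period (1 - 2 * ε) 1
      + (2 : Torus) • (coordOp ε 0 (period (1 - 2 * ε) 1) + zRest • period (1 - 2 * ε) 1)
      - zDot • period (1 - 2 * ε) 1)) := by
  have H := congrArg (coordOp ε 0) (hypergeometric_z hε)
  simp only [weylRep_gkz3_apply, coordOp_one, coordOp_two, coordOp_zero_smul, complex_smul,
    derivOp_one_smul, derivOp_two_smul, derivOp_coordOp, derivOp_zero_period, derivOp_zero_smul,
    derivOp_one_period, derivOp_two_period, pd_var, pd_zero_inv, pd_one_inv, map_sub, map_add,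
    smul_add, tEuler_smul, tEuler_coordOp, derivation_two,
    tEuler_period, Derivation.leibniz, Derivation.leibniz_pow, dlog_var, dlog_inv,
    derivation_half, derivation_ofNat, zRest, zDot] at H ⊢
  simp at H ⊢
  linear_combination (norm := skip) H
  match_scalars
  all_goals try ring1
  · linear_combination -(2 * var 0 * inv 2 + 3 * var 1 * inv 2 ^ 2) * two_mul_half
  · linear_combination -two_mul_half

lemma gkz4_period : weylRep (isWeylRep_torus ε) gkz4 (period (1 - 2 * ε) 0) =
    tEuler (-((var 0 * var 1 * inv 2 ^ 2) • coordOp ε 0 (period (1 - 2 * ε) 1))) := by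
  simp only [weylRep_gkz4_apply, coordOp_one, coordOp_two, coordOp_zero_smul, complex_smul,
    derivOp_two_smul, derivOp_zero_period, derivOp_zero_smul, Derivation.leibniz_pow,
    derivOp_one_period, derivOp_two_period, pd_var, pd_one_inv, map_add,
    smul_add, tEuler_smul, tEuler_coordOp, derivation_two,
    tEuler_period, Derivation.leibniz, dlog_var, dlog_inv, map_neg]
  simp
  rw [zDot]
  have h := var_mul_inv 2
  linear_combination (norm := module)
    (var 0 * var 1 * inv 2 * h) • coordOp ε 0 (period (1 - 2 * ε) 2)

lemma newEq_period (hε : ε = 0 ∨ ε = 1) :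
    weylRep (isWeylRep_torus ε) newEq (period (1 - 2 * ε) 0) =
    tEuler ((var 0 * var 1) • coordOp ε 0 (inv 2 • period (1 - 2 * ε) 0
      + (-4 + 4 * inv 2 - 12 * var 0 * inv 2 ^ 2 + 2 * var 1 * inv 2 ^ 3) • period (1 - 2 * ε) 1
      + (-8 * inv 2 + 4 * inv 2 ^ 2) • coordOp ε 0 (period (1 - 2 * ε) 1))) := by
  -- The hypergeometric equation enters with the multiplier `-4 p q r / t`.
  have H := congrArg (coordOp ε 0) (hypergeometric_z hε)
  simp only [weylRep_newEq_apply, coordOp_one, coordOp_two, coordOp_zero_smul, complex_smul,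
    derivOp_one_smul, derivOp_two_smul, derivOp_coordOp, derivOp_zero_period, derivOp_zero_smul,
    derivOp_one_period, derivOp_two_period, pd_var, pd_zero_inv, pd_one_inv, map_sub, map_add,
    smul_add, tEuler_smul, tEuler_coordOp, derivation_two, derivation_ofNat,
    tEuler_period, Derivation.leibniz, Derivation.leibniz_pow, dlog_var, dlog_inv, map_neg,
    derivation_ofNat, zRest, zDot] at H ⊢
  simp at H ⊢
  linear_combination (norm := skip) (-4 * inv 2 * var 0 * var 1) • H
  have h := var_mul_inv 2
  match_scalars
  all_goals try ring1
  · linear_combination -9 * var 0 * var 1 * h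
  · linear_combination (-4 * var 0 * var 1 * var 2 - 10 * var 0 * var 1 ^ 2 * inv 2 ^ 2
      + 4 * var 0 ^ 2 * var 1 * inv 2) * h
  · linear_combination -4 * var 0 * var 1 * inv 2 * h
  · linear_combination -var 0 * var 1 * inv 2 * (2 * half + 1) * two_mul_half

end Period

/-! ### Principal symbols and the conormal directions at double roots -/

section Conormal

open MvPolynomial

section PrincipalSymbol

lemma principalSymbolAt_add {f g : MvPolynomial (Fin 3) Poly} {n : ℕ} (hf : f.IsHomogeneous n)
    (hf0 : f ≠ 0) (hg : g.totalDegree < n) (x ξ : Fin 3 → ℂ) :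
    principalSymbolAt (f + g) x ξ = MvPolynomial.eval ξ (map (MvPolynomial.eval x) f) := by
  have hd : f.totalDegree = n := hf.totalDegree hf0
  rw [principalSymbolAt, totalDegree_add_eq_left_of_totalDegree_lt (by rwa [hd]), hd, map_add,
    homogeneousComponent_eq_zero n g hg, add_zero,
    homogeneousComponent_of_mem ((mem_homogeneousSubmodule n f).2 hf), if_pos rfl]

lemma principalSymbolAt_eq_sum (f : MvPolynomial (Fin 3) Poly) (x ξ : Fin 3 → ℂ) :
    principalSymbolAt f x ξ = ∑ α ∈ f.support with α.degree = f.totalDegree,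
      MvPolynomial.eval x (f.coeff α) * (ξ 0 ^ α 0 * ξ 1 ^ α 1 * ξ 2 ^ α 2) := by
  rw [principalSymbolAt, homogeneousComponent_apply, map_sum, map_sum]
  refine Finset.sum_congr rfl fun α _ => ?_
  rw [map_monomial, eval_monomial, Finsupp.prod_fintype _ _ (by simp), Fin.prod_univ_three]

end PrincipalSymbol

section LeadingTerm

/-- Formal sums of basis distributions of index at least `N`. -/
def suppGE (N : ℤ) : Submodule ℂ (ℤ → Torus) where
  carrier := {c | ∀ k < N, c k = 0}
  add_mem' ha hb k hk := by rw [Pi.add_apply, ha k hk, hb k hk, add_zero]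
  zero_mem' _ _ := rfl
  smul_mem' a c hc k hk := by rw [Pi.smul_apply, hc k hk, smul_zero]

/-- Formal sums of basis distributions whose indices are bounded below. -/
def bddBelow : Submodule ℂ (ℤ → Torus) where
  carrier := {c | ∃ N, c ∈ suppGE N}
  add_mem' := by
    rintro a b ⟨M, ha⟩ ⟨N, hb⟩
    exact ⟨min M N, (suppGE _).add_mem (fun k hk => ha k (lt_of_lt_of_le hk (min_le_left _ _)))
      (fun k hk => hb k (lt_of_lt_of_le hk (min_le_right _ _)))⟩
  zero_mem' := ⟨0, (suppGE 0).zero_mem⟩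
  smul_mem' a c := fun ⟨N, hc⟩ => ⟨N, (suppGE N).smul_mem a hc⟩

variable {N : ℤ} {c : ℤ → Torus} {ε : ℂ}

lemma smul_mem_suppGE (a : Torus) (hc : c ∈ suppGE N) : a • c ∈ suppGE N := fun k hk => by
  rw [Pi.smul_apply, hc k hk, smul_zero]

lemma onCoeff_mem_suppGE (d : Derivation ℂ Torus Torus) (hc : c ∈ suppGE N) :
    onCoeff d c ∈ suppGE N := fun k hk => by rw [onCoeff_apply, hc k hk, map_zero]

lemma yMul_mem_suppGE (hc : c ∈ suppGE N) : yMul c ∈ suppGE N := fun k hk => by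
  rw [yMul_apply, hc _ (by lia), smul_zero]

lemma yDeriv_mem_suppGE (hc : c ∈ suppGE N) : yDeriv c ∈ suppGE (N - 1) := fun k hk => by
  rw [yDeriv_apply, hc _ (by lia)]

lemma suppGE_sub_one (hc : c ∈ suppGE N) : c ∈ suppGE (N - 1) := fun k hk => hc k (by lia)

/-- The restrictions of `p, q, r` to the hypersurface `y = 0`. -/
def coordVal (ε : ℂ) : Fin 3 → Torus :=
  ![algebraMap ℂ Torus ε - zRest, Torus.var 0, Torus.var 1]

/-- The differential of `z` with respect to `p, q, r`. -/
def covector : Fin 3 → Torus := ![1, Torus.inv 2, Torus.inv 2 ^ 2]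

lemma coordOp_mem_suppGE (i : Fin 3) (hc : c ∈ suppGE N) : coordOp ε i c ∈ suppGE N := by
  fin_cases i
  · exact (suppGE N).add_mem (yMul_mem_suppGE hc) (smul_mem_suppGE _ hc)
  · exact smul_mem_suppGE _ hc
  · exact smul_mem_suppGE _ hc

lemma coordOp_lead (i : Fin 3) (hc : c ∈ suppGE N) :
    coordOp ε i c N = coordVal ε i * c N := by
  fin_cases i
  · change yMul c N + _ = _
    rw [yMul_apply, hc _ (by lia), smul_zero, zero_add]
    rfl
  · rfl
  · rfl

lemma derivOp_mem_suppGE (i : Fin 3) (hc : c ∈ suppGE N) : derivOp i c ∈ suppGE (N - 1) := by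
  fin_cases i
  · exact yDeriv_mem_suppGE hc
  · exact (suppGE _).add_mem (suppGE_sub_one (onCoeff_mem_suppGE _ hc))
      (smul_mem_suppGE _ (yDeriv_mem_suppGE hc))
  · exact (suppGE _).add_mem (suppGE_sub_one (onCoeff_mem_suppGE _ hc))
      (smul_mem_suppGE _ (yDeriv_mem_suppGE hc))

lemma yDeriv_lead (N : ℤ) (c : ℤ → Torus) : yDeriv c (N - 1) = c N := by
  rw [yDeriv_apply, sub_add_cancel]

lemma derivOp_lead (i : Fin 3) (hc : c ∈ suppGE N) :
    derivOp i c (N - 1) = covector i * c N := by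
  fin_cases i
  · change yDeriv c (N - 1) = 1 * c N
    rw [yDeriv_lead, one_mul]
  · change onCoeff (Torus.pd 0) c (N - 1) + Torus.inv 2 * yDeriv c (N - 1) = _
    rw [onCoeff_mem_suppGE _ hc _ (by lia), zero_add, yDeriv_lead]
    rfl
  · change onCoeff (Torus.pd 1) c (N - 1) + Torus.inv 2 ^ 2 * yDeriv c (N - 1) = _
    rw [onCoeff_mem_suppGE _ hc _ (by lia), zero_add, yDeriv_lead]
    rfl

lemma tEuler_lead (hc : c ∈ suppGE N) : tEuler c (N - 1) = zDot * c N := by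
  change onCoeff (Torus.dlog 2) c (N - 1) + zDot * yDeriv c (N - 1) = _
  rw [onCoeff_mem_suppGE _ hc _ (by lia), zero_add, yDeriv_lead]

lemma coordOp_pow_lead (i : Fin 3) (n : ℕ) (hc : c ∈ suppGE N) :
    (coordOp ε i ^ n) c ∈ suppGE N ∧ (coordOp ε i ^ n) c N = coordVal ε i ^ n * c N := by
  induction n with
  | zero => simpa using hc
  | succ n ih =>
    rw [pow_succ', Module.End.mul_apply]
    exact ⟨coordOp_mem_suppGE i ih.1, by rw [coordOp_lead i ih.1, ih.2]; ring⟩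

lemma derivOp_pow_lead (i : Fin 3) (n : ℕ) (hc : c ∈ suppGE N) :
    (derivOp i ^ n) c ∈ suppGE (N - n) ∧ (derivOp i ^ n) c (N - n) = covector i ^ n * c N := by
  induction n with
  | zero => simpa using hc
  | succ n ih =>
    rw [pow_succ', Module.End.mul_apply, Nat.cast_succ, ← sub_sub]
    exact ⟨derivOp_mem_suppGE i ih.1, by rw [derivOp_lead i ih.1, ih.2]; ring⟩

lemma polyAct_coordOp_lead (g : Poly) (hc : c ∈ suppGE N) :
    polyAct (coordOp ε) g c ∈ suppGE N ∧
      polyAct (coordOp ε) g c N = aeval (coordVal ε) g * c N := by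
  induction g using MvPolynomial.induction_on' with
  | monomial β a =>
    obtain ⟨h2, h2'⟩ := coordOp_pow_lead (ε := ε) 2 (β 2) hc
    obtain ⟨h1, h1'⟩ := coordOp_pow_lead (ε := ε) 1 (β 1) h2
    obtain ⟨h0, h0'⟩ := coordOp_pow_lead (ε := ε) 0 (β 0) h1
    rw [polyAct_monomial, LinearMap.smul_apply, opPow, Module.End.mul_apply, Module.End.mul_apply]
    refine ⟨(suppGE N).smul_mem a h0, ?_⟩
    rw [Pi.smul_apply, h0', h1', h2', aeval_monomial, Finsupp.prod_fintype _ _ (by simp),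
      Fin.prod_univ_three, Algebra.smul_def]
    ring
  | add a b ha hb =>
    rw [polyAct_add, LinearMap.add_apply, map_add, add_mul, Pi.add_apply, ha.2, hb.2]
    exact ⟨(suppGE N).add_mem ha.1 hb.1, rfl⟩

lemma opPow_derivOp_lead (α : Fin 3 →₀ ℕ) (hc : c ∈ suppGE 0) :
    opPow derivOp α c ∈ suppGE (-(α.degree : ℤ)) ∧ opPow derivOp α c (-(α.degree : ℤ)) =
      covector 0 ^ α 0 * covector 1 ^ α 1 * covector 2 ^ α 2 * c 0 := by
  obtain ⟨h2, h2'⟩ := derivOp_pow_lead 2 (α 2) hc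
  obtain ⟨h1, h1'⟩ := derivOp_pow_lead 1 (α 1) h2
  obtain ⟨h0, h0'⟩ := derivOp_pow_lead 0 (α 0) h1
  have hd : (-(α.degree : ℤ)) = 0 - (α 2 : ℤ) - (α 1 : ℤ) - (α 0 : ℤ) := by
    rw [Finsupp.degree_eq_sum, Fin.sum_univ_three]; push_cast; ring
  rw [hd, opPow, Module.End.mul_apply, Module.End.mul_apply]
  exact ⟨h0, by rw [h0', h1', h2']; ring⟩

lemma le_totalDegree_of_mem {f : MvPolynomial (Fin 3) Poly} {α : Fin 3 →₀ ℕ}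
    (hα : α ∈ f.support) : α.degree ≤ f.totalDegree := by
  have := le_totalDegree hα
  rwa [Finsupp.sum, ← Finsupp.degree_apply] at this

/-- The leading coefficient of `L w` is the principal symbol of `L`, at the differential of `z`,
times that of `w`. -/
lemma symAct_lead (f : MvPolynomial (Fin 3) Poly) (hc : c ∈ suppGE 0) :
    symAct (coordOp ε) derivOp f c (-(f.totalDegree : ℤ)) =
      (∑ α ∈ f.support with α.degree = f.totalDegree, aeval (coordVal ε) (f.coeff α) *
        (covector 0 ^ α 0 * covector 1 ^ α 1 * covector 2 ^ α 2)) * c 0 := by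
  rw [symAct, MvPolynomial.sum_def, LinearMap.sum_apply, Finset.sum_apply, Finset.sum_filter,
    Finset.sum_mul]
  refine Finset.sum_congr rfl fun α hα => ?_
  obtain ⟨h1, h2⟩ := opPow_derivOp_lead α hc
  obtain ⟨h3, h4⟩ := polyAct_coordOp_lead (ε := ε) (f.coeff α) h1
  rw [Module.End.mul_apply]
  split_ifs with h
  · rw [← h, h4, h2]; ring
  · rw [zero_mul]
    exact h3 _ (by have := le_totalDegree_of_mem hα; lia)

lemma bddBelow_smul (a : Torus) (hc : c ∈ bddBelow) : a • c ∈ bddBelow :=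
  hc.imp fun _ h => smul_mem_suppGE a h

lemma bddBelow_coordOp (i : Fin 3) (hc : c ∈ bddBelow) : coordOp ε i c ∈ bddBelow :=
  hc.imp fun _ h => coordOp_mem_suppGE i h

lemma bddBelow_derivOp (i : Fin 3) (hc : c ∈ bddBelow) : derivOp i c ∈ bddBelow :=
  let ⟨_, h⟩ := hc; ⟨_, derivOp_mem_suppGE i h⟩

lemma period_zero_mem_suppGE (κ : ℂ) : period κ 0 ∈ suppGE 0 := fun k hk => by
  rw [period_zero_apply, if_neg (by lia)]

lemma period_mem_bddBelow (κ : ℂ) (n : ℕ) : period κ n ∈ bddBelow := by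
  induction n with
  | zero => exact ⟨0, period_zero_mem_suppGE κ⟩
  | succ n ih => exact derivOp_zero_period κ n ▸ bddBelow_derivOp 0 ih

lemma zDot_ne_zero : zDot ≠ 0 := by
  intro h
  have h1 : Torus.eval ![1, 1, 1] zDot = 0 := by rw [h, map_zero]
  rw [zDot, map_sub, map_mul, map_mul, map_ofNat] at h1
  simp [Torus.eval_var, Torus.eval_inv] at h1

/-- The lowest coefficient of `t ∂c/∂t`, for `c` bounded below, is divisible by `t ∂z/∂t`. -/
lemma zDot_dvd_tEuler (hc : c ∈ bddBelow) (h : tEuler c ∈ suppGE N) : zDot ∣ tEuler c N := by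
  -- Since `t ∂z/∂t` is not a zero divisor, `c` starts exactly one step above `t ∂c/∂t`.
  have hc' : ∃ n : ℕ, c ∈ suppGE (N + 1 - n) := by
    obtain ⟨M, hM⟩ := hc
    exact ⟨(N + 1 - M).natAbs, fun k hk => hM k (by lia)⟩
  obtain ⟨n, hn⟩ := hc'
  have h0 : c ∈ suppGE (N + 1) := by
    induction n with
    | zero => simpa using hn
    | succ n ih =>
      apply ih
      have h1 := tEuler_lead hn
      rw [h _ (by lia)] at h1
      have h2 := (mul_eq_zero.1 h1.symm).resolve_left zDot_ne_zero
      intro k hk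
      by_cases hk' : k = N + 1 - ((n + 1 : ℕ) : ℤ)
      · exact hk' ▸ h2
      · exact hn k (by lia)
  have h1 := tEuler_lead h0
  rw [add_sub_cancel_right] at h1
  exact ⟨_, h1⟩

lemma symAct_mem_suppGE (f : MvPolynomial (Fin 3) Poly) (hc : c ∈ suppGE 0) :
    symAct (coordOp ε) derivOp f c ∈ suppGE (-(f.totalDegree : ℤ)) := by
  rw [symAct, MvPolynomial.sum_def, LinearMap.sum_apply]
  refine Submodule.sum_mem _ fun α hα => ?_
  have h3 := (polyAct_coordOp_lead (ε := ε) (f.coeff α) (opPow_derivOp_lead α hc).1).1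
  exact fun k hk => h3 k (by have := le_totalDegree_of_mem hα; lia)

/-- Modulo derivatives in `t`, all operators of the Picard–Fuchs ideal annihilate the period. -/
lemma symAct_period_mem (hε : ε = 0 ∨ ε = 1) {L : Weyl} (hL : L ∈ picardFuchs)
    {f : MvPolynomial (Fin 3) Poly} (hf : ofSymbol f = (L : Module.End ℂ Poly)) :
    symAct (coordOp ε) derivOp f (period (1 - 2 * ε) 0) ∈ bddBelow.map tEuler := by
  refine symAct_mem_of_mem_span (isWeylRep_torus ε) ?_ ?_ ?_ hL hf
  · rintro i _ ⟨c, hc, rfl⟩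
    exact ⟨_, bddBelow_coordOp i hc, tEuler_coordOp ε i c⟩
  · rintro i _ ⟨c, hc, rfl⟩
    exact ⟨_, bddBelow_derivOp i hc, tEuler_derivOp i c⟩
  · have hp := period_mem_bddBelow (1 - 2 * ε)
    rintro L (rfl | rfl | rfl | rfl | rfl)
    · rw [gkz1_period]; exact Submodule.zero_mem _
    · rw [gkz2_period]
      exact ⟨_, Submodule.neg_mem _ (bddBelow_smul _ (bddBelow_coordOp _ (bddBelow_coordOp _
        (hp 1)))), rfl⟩
    · rw [gkz3_period hε]
      exact ⟨_, bddBelow_coordOp _ (Submodule.sub_mem _ (Submodule.add_mem _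
        (Submodule.sub_mem _ (hp 0) (hp 1)) (bddBelow_smul _ (Submodule.add_mem _
        (bddBelow_coordOp _ (hp 1)) (bddBelow_smul _ (hp 1))))) (bddBelow_smul _ (hp 1))), rfl⟩
    · rw [gkz4_period]
      exact ⟨_, Submodule.neg_mem _ (bddBelow_smul _ (bddBelow_coordOp _ (hp 1))), rfl⟩
    · rw [newEq_period hε]
      exact ⟨_, bddBelow_smul _ (bddBelow_coordOp _ (Submodule.add_mem _ (Submodule.add_mem _
        (bddBelow_smul _ (hp 0)) (bddBelow_smul _ (hp 1))) (bddBelow_smul _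
        (bddBelow_coordOp _ (hp 1))))), rfl⟩

/-- The covector `dz` is characteristic at a point where the equation `z = ε` has a double root
`t`. -/
lemma doubleRoot_mem_charVariety (hε : ε = 0 ∨ ε = 1) {q r t : ℂ} (hq : q ≠ 0) (hr : r ≠ 0)
    (ht : t ≠ 0) (hd : t - q * t⁻¹ - 2 * r * t⁻¹ ^ 2 = 0) :
    (![ε - (t + q * t⁻¹ + r * t⁻¹ ^ 2), q, r], ![1, t⁻¹, t⁻¹ ^ 2]) ∈ charVariety picardFuchs := by
  intro L hL f hf
  obtain ⟨c, hc, hcf⟩ := symAct_period_mem hε hL hf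
  have hp := period_zero_mem_suppGE (1 - 2 * ε)
  have hdvd := zDot_dvd_tEuler hc (hcf ▸ symAct_mem_suppGE f hp)
  rw [hcf, symAct_lead f hp] at hdvd
  have hp0 : period (1 - 2 * ε) 0 0 = 1 := by
    rw [period_zero_apply, if_pos le_rfl]; simp [hyperCoeff, AddMonoidAlgebra.one_def]
  rw [hp0, mul_one] at hdvd
  let e := Torus.eval ![Units.mk0 q hq, Units.mk0 r hr, Units.mk0 t ht]
  have hz : e zDot = 0 := by
    simp only [e, zDot, map_sub, map_mul, map_pow, map_ofNat, Torus.eval_var, Torus.eval_inv]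
    exact hd
  have he : e (∑ α ∈ f.support with α.degree = f.totalDegree, aeval (coordVal ε) (f.coeff α) *
        (covector 0 ^ α 0 * covector 1 ^ α 1 * covector 2 ^ α 2)) = 0 := by
    obtain ⟨a, ha⟩ := hdvd
    rw [ha, map_mul, hz, zero_mul]
  rw [principalSymbolAt_eq_sum, ← he, map_sum]
  refine Finset.sum_congr rfl fun α _ => ?_
  rw [map_mul, ← AlgHom.comp_apply, comp_aeval, ← MvPolynomial.coe_aeval_eq_eval]
  have hx : (fun i => e (coordVal ε i)) = ![ε - (t + q * t⁻¹ + r * t⁻¹ ^ 2), q, r] := by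
    ext i
    fin_cases i
    · change e (algebraMap ℂ Torus ε - zRest) = _
      rw [map_sub, AlgHom.commutes, zRest]
      simp [e, Torus.eval_var, Torus.eval_inv]
    · simp [e, coordVal, Torus.eval_var]
    · simp [e, coordVal, Torus.eval_var]
  have hξ : ∀ i, e (covector i) = ![1, t⁻¹, t⁻¹ ^ 2] i := by
    intro i
    fin_cases i <;> simp [e, covector, Torus.eval_inv]
  simp only [map_mul, map_pow, hξ]
  congr 2
  rw [← hx]; rfl

end LeadingTerm

end Conormal

/-! ### The coordinate planes -/

section CoordinatePlanes

open MvPolynomial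

/-- Multiplication by the coordinates on formal sums `∑ c_γ e_γ`, `γ ∈ ℤ³`, of products of basis
distributions in the three variables `p, q, r`. -/
def latMul (i : Fin 3) : Module.End ℂ ((Fin 3 → ℤ) → ℂ) where
  toFun c γ := (γ i : ℂ) * c (γ - Pi.single i 1)
  map_add' c d := by ext1 γ; simp [mul_add]
  map_smul' a c := by ext1 γ; simp [mul_left_comm]

/-- The partial derivatives on formal sums of products of basis distributions. -/
def latDeriv (i : Fin 3) : Module.End ℂ ((Fin 3 → ℤ) → ℂ) where
  toFun c γ := c (γ + Pi.single i 1)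
  map_add' _ _ := rfl
  map_smul' _ _ := rfl

lemma latMul_apply (i : Fin 3) (c : (Fin 3 → ℤ) → ℂ) (γ : Fin 3 → ℤ) :
    latMul i c γ = (γ i : ℂ) * c (γ - Pi.single i 1) := rfl

lemma latDeriv_apply (i : Fin 3) (c : (Fin 3 → ℤ) → ℂ) (γ : Fin 3 → ℤ) :
    latDeriv i c γ = c (γ + Pi.single i 1) := rfl

lemma isWeylRep_lat : IsWeylRep latMul latDeriv where
  comm_X i j := LinearMap.ext fun c => funext fun γ => by
    simp only [Module.End.mul_apply, latMul_apply]
    by_cases h : i = j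
    · rw [h]
    · simp only [Pi.sub_apply, Pi.single_apply, h, Ne.symm h, if_false, sub_zero, sub_right_comm]
      ring
  comm_D i j := LinearMap.ext fun c => funext fun γ => by
    simp only [Module.End.mul_apply, latDeriv_apply, add_right_comm]
  D_mul_X i j := LinearMap.ext fun c => funext fun γ => by
    rw [LinearMap.add_apply, Pi.add_apply]
    simp only [Module.End.mul_apply, latMul_apply, latDeriv_apply, Pi.add_apply]
    by_cases h : i = j
    · subst h
      simp
      ring
    · simp [h, Ne.symm h, sub_add_eq_add_sub]

/-- The Euler operator of the `i`-th coordinate: `e_γ` is an eigenvector with eigenvalue `γ i`. -/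
def latEuler (i : Fin 3) (c : (Fin 3 → ℤ) → ℂ) : (Fin 3 → ℤ) → ℂ := fun γ => (γ i : ℂ) * c γ

lemma latMul_latDeriv (i : Fin 3) (c : (Fin 3 → ℤ) → ℂ) :
    latMul i (latDeriv i c) = latEuler i c := by
  ext1 γ; rw [latMul_apply, latDeriv_apply, sub_add_cancel]; rfl

/-- The coefficients `(1/2)_n² / n!`, extended by zero. -/
def pochCoeff (n : ℤ) : ℂ :=
  if 0 ≤ n then ∏ j ∈ Finset.range n.toNat, (((j : ℂ) + 1 / 2) ^ 2 / (j + 1)) else 0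

/-- The coefficients `1 / n!`, extended by zero. -/
def invFactorial (n : ℤ) : ℂ := if 0 ≤ n then ((n.toNat.factorial : ℂ))⁻¹ else 0

lemma pochCoeff_rec (n : ℤ) : (n : ℂ) * pochCoeff n = (n - 1 / 2 : ℂ) ^ 2 * pochCoeff (n - 1) := by
  unfold pochCoeff
  rcases lt_trichotomy n 0 with h | rfl | h
  · rw [if_neg (by lia), if_neg (by lia), mul_zero, mul_zero]
  · simp
  · obtain ⟨m, rfl⟩ : ∃ m : ℕ, n = m + 1 := ⟨(n - 1).toNat, by lia⟩
    have : (m : ℂ) + 1 ≠ 0 := Nat.cast_add_one_ne_zero m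
    rw [if_pos (by lia), if_pos (by lia), show ((m : ℤ) + 1).toNat = m + 1 from rfl,
      add_sub_cancel_right, Int.toNat_natCast, Finset.prod_range_succ]
    generalize ∏ j ∈ Finset.range m, (((j : ℂ) + 1 / 2) ^ 2 / (j + 1)) = a
    push_cast
    field_simp
    ring

lemma invFactorial_rec (n : ℤ) : (n : ℂ) * invFactorial n = invFactorial (n - 1) := by
  unfold invFactorial
  rcases lt_trichotomy n 0 with h | rfl | h
  · rw [if_neg (by lia), if_neg (by lia), mul_zero]
  · simp
  · obtain ⟨m, rfl⟩ : ∃ m : ℕ, n = m + 1 := ⟨(n - 1).toNat, by lia⟩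
    have : (m : ℂ) + 1 ≠ 0 := Nat.cast_add_one_ne_zero m
    rw [if_pos (by lia), if_pos (by lia), show ((m : ℤ) + 1).toNat = m + 1 from rfl,
      add_sub_cancel_right, Int.toNat_natCast, Nat.factorial_succ]
    push_cast
    field_simp

/-- The coefficients of the constant term in `t` of `F(t + p + q / t + r / t²)` with respect to the
divided powers of `p`, `q`, `r`. The formula is used at all integer exponents, not only at
nonnegative ones. -/
def seriesCoeff (γ : Fin 3 → ℤ) : ℂ :=
  pochCoeff (γ 0 + 2 * γ 1 + 3 * γ 2) * invFactorial (γ 1 + 2 * γ 2)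

lemma lat_gkz1 : weylRep isWeylRep_lat gkz1 seriesCoeff = 0 := by
  ext1 γ
  simp only [weylRep_gkz1_apply, latMul_latDeriv]
  simp [latMul_apply, latEuler, seriesCoeff]
  ring_nf

lemma lat_gkz2 : weylRep isWeylRep_lat gkz2 seriesCoeff = 0 := by
  ext1 γ
  simp only [weylRep_gkz2_apply, latMul_latDeriv]
  simp [latMul_apply, latEuler, seriesCoeff]
  have h := invFactorial_rec (γ 1 + 2 * γ 2)
  push_cast at h
  ring_nf at h ⊢
  linear_combination (γ 0 * (γ 0 - 1) * γ 1 * pochCoeff (-2 + γ 1 * 2 + γ 2 * 3 + γ 0) : ℂ) * h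

lemma lat_gkz3 : weylRep isWeylRep_lat gkz3 seriesCoeff = 0 := by
  ext1 γ
  simp only [weylRep_gkz3_apply, latMul_latDeriv]
  simp [latMul_apply, latEuler, seriesCoeff]
  have h := pochCoeff_rec (γ 0 + 2 * γ 1 + 3 * γ 2)
  push_cast at h
  ring_nf at h ⊢
  linear_combination (γ 0 * invFactorial (γ 1 + γ 2 * 2) : ℂ) * h

lemma lat_gkz4 : weylRep isWeylRep_lat gkz4 seriesCoeff = 0 := by
  ext1 γ
  simp only [weylRep_gkz4_apply, latMul_latDeriv]
  simp [latMul_apply, latEuler, seriesCoeff]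
  have h := invFactorial_rec (γ 1 - 1 + 2 * γ 2)
  push_cast at h
  ring_nf at h ⊢
  linear_combination (γ 0 * γ 1 * γ 2 * pochCoeff (-3 + γ 1 * 2 + γ 2 * 3 + γ 0) : ℂ) * h

lemma lat_newEq : weylRep isWeylRep_lat newEq seriesCoeff = 0 := by
  ext1 γ
  simp only [weylRep_newEq_apply, latMul_latDeriv]
  simp [latMul_apply, latEuler, seriesCoeff]
  have h1 := invFactorial_rec (γ 1 - 1 + 2 * γ 2)
  have h2 := invFactorial_rec (γ 1 - 2 + 2 * γ 2)
  have h := pochCoeff_rec (γ 0 + 2 * γ 1 + 3 * γ 2 - 4)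
  push_cast at h h1 h2
  ring_nf at h h1 h2 ⊢
  linear_combination
    (-9 * γ 0 * γ 1 * γ 2 * (2 * γ 2 - 1) * pochCoeff (-5 + γ 0 + γ 1 * 2 + γ 2 * 3) : ℂ) * h2
    - (4 * γ 0 * (γ 0 - 1) * γ 1 * γ 2 * pochCoeff (-4 + γ 0 + γ 1 * 2 + γ 2 * 3) : ℂ) * h1
    - (4 * γ 0 * γ 1 * γ 2 * invFactorial (-2 + γ 1 + γ 2 * 2) : ℂ) * h

/-- Cutting off a formal sum to nonnegative indices. -/
def cutoff : Module.End ℂ ((Fin 3 → ℤ) → ℂ) where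
  toFun c γ := if ∀ i, 0 ≤ γ i then c γ else 0
  map_add' c d := by ext1 γ; by_cases h : ∀ i, 0 ≤ γ i <;> simp [h]
  map_smul' a c := by ext1 γ; by_cases h : ∀ i, 0 ≤ γ i <;> simp [h]

lemma cutoff_apply (c : (Fin 3 → ℤ) → ℂ) (γ : Fin 3 → ℤ) :
    cutoff c γ = if ∀ i, 0 ≤ γ i then c γ else 0 := rfl

lemma latMul_cutoff (i : Fin 3) (c : (Fin 3 → ℤ) → ℂ) :
    latMul i (cutoff c) = cutoff (latMul i c) := by
  ext1 γ
  rw [cutoff_apply, latMul_apply, latMul_apply, cutoff_apply]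
  by_cases hγ : γ i = 0
  · simp [hγ]
  · have : (∀ j, 0 ≤ (γ - Pi.single i 1 : Fin 3 → ℤ) j) ↔ ∀ j, 0 ≤ γ j := by
      refine forall_congr' fun j => ?_
      by_cases hj : j = i
      · subst hj
        rw [Pi.sub_apply, Pi.single_eq_same]
        lia
      · rw [Pi.sub_apply, Pi.single_eq_of_ne hj, sub_zero]
    simp only [this]
    split_ifs <;> simp

lemma latEuler_cutoff (i : Fin 3) (c : (Fin 3 → ℤ) → ℂ) :
    latEuler i (cutoff c) = cutoff (latEuler i c) := by
  rw [← latMul_latDeriv, ← latMul_latDeriv]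
  ext1 γ
  simp only [cutoff_apply, latMul_apply, latDeriv_apply, sub_add_cancel]
  split_ifs <;> simp

/-- The generators only involve the derivatives through Euler operators, so they commute with the
cut-off. -/
lemma weylRep_cutoff {L : Weyl} (hL : L ∈ ({gkz1, gkz2, gkz3, gkz4, newEq} : Set Weyl))
    (c : (Fin 3 → ℤ) → ℂ) :
    weylRep isWeylRep_lat L (cutoff c) = cutoff (weylRep isWeylRep_lat L c) := by
  rcases hL with rfl | rfl | rfl | rfl | rfl <;>
    simp only [weylRep_gkz1_apply, weylRep_gkz2_apply, weylRep_gkz3_apply, weylRep_gkz4_apply,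
      weylRep_newEq_apply, latMul_latDeriv, latMul_cutoff, latEuler_cutoff, ← map_add, ← map_sub,
      ← map_smul]

lemma lat_cutoff_series {L : Weyl} (hL : L ∈ ({gkz1, gkz2, gkz3, gkz4, newEq} : Set Weyl)) :
    weylRep isWeylRep_lat L (cutoff seriesCoeff) = 0 := by
  rw [weylRep_cutoff hL]
  rcases hL with rfl | rfl | rfl | rfl | rfl
  · rw [lat_gkz1, map_zero]
  · rw [lat_gkz2, map_zero]
  · rw [lat_gkz3, map_zero]
  · rw [lat_gkz4, map_zero]
  · rw [lat_newEq, map_zero]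

lemma latDeriv_pow_apply (i : Fin 3) (n : ℕ) (c : (Fin 3 → ℤ) → ℂ) (γ : Fin 3 → ℤ) :
    (latDeriv i ^ n) c γ = c (γ + Pi.single i (n : ℤ)) := by
  induction n generalizing γ with
  | zero => simp
  | succ n ih =>
    rw [pow_succ', Module.End.mul_apply, latDeriv_apply, ih, add_assoc, ← Pi.single_add]
    push_cast
    rw [add_comm (1 : ℤ)]

lemma latMul_pow_apply (i : Fin 3) (n : ℕ) (c : (Fin 3 → ℤ) → ℂ) (γ : Fin 3 → ℤ) :
    (latMul i ^ n) c γ =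
      (∏ j ∈ Finset.range n, ((γ i : ℂ) - j)) * c (γ - Pi.single i (n : ℤ)) := by
  induction n generalizing γ with
  | zero => simp
  | succ n ih =>
    rw [pow_succ', Module.End.mul_apply, latMul_apply, ih, sub_sub, ← Pi.single_add,
      Finset.prod_range_succ']
    push_cast
    rw [add_comm (1 : ℤ), Pi.sub_apply, Pi.single_eq_same]
    push_cast
    simp only [sub_sub, add_comm (1 : ℂ), sub_zero]
    ring

lemma opPow_latDeriv_apply (α : Fin 3 →₀ ℕ) (c : (Fin 3 → ℤ) → ℂ) (γ : Fin 3 → ℤ) :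
    opPow latDeriv α c γ = c (γ + fun i => (α i : ℤ)) := by
  simp only [opPow, Module.End.mul_apply, latDeriv_pow_apply]
  congr 1
  ext i
  fin_cases i <;> simp

lemma opPow_latMul_apply (β : Fin 3 →₀ ℕ) (c : (Fin 3 → ℤ) → ℂ) (γ : Fin 3 → ℤ) :
    opPow latMul β c γ =
      (∏ i, ∏ j ∈ Finset.range (β i), ((γ i : ℂ) - j)) * c (γ - fun i => (β i : ℤ)) := by
  simp only [opPow, Module.End.mul_apply, latMul_pow_apply, Fin.prod_univ_three]
  have : γ - Pi.single 0 (β 0 : ℤ) - Pi.single 1 (β 1 : ℤ) - Pi.single 2 (β 2 : ℤ) =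
      γ - fun i => (β i : ℤ) := by
    ext i
    fin_cases i <;> simp
  rw [this]
  simp
  ring

lemma symAct_lat_apply (f : MvPolynomial (Fin 3) Poly) (c : (Fin 3 → ℤ) → ℂ) (γ : Fin 3 → ℤ) :
    symAct latMul latDeriv f c γ = ∑ α ∈ f.support, ∑ β ∈ (f.coeff α).support,
      (f.coeff α).coeff β * ((∏ i, ∏ j ∈ Finset.range (β i), ((γ i : ℂ) - j)) *
        c ((γ - fun i => (β i : ℤ)) + fun i => (α i : ℤ))) := by
  rw [symAct, MvPolynomial.sum_def, LinearMap.sum_apply, Finset.sum_apply]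
  refine Finset.sum_congr rfl fun α _ => ?_
  rw [Module.End.mul_apply, polyAct, MvPolynomial.sum_def, LinearMap.sum_apply, Finset.sum_apply]
  refine Finset.sum_congr rfl fun β _ => ?_
  rw [LinearMap.smul_apply, Pi.smul_apply, opPow_latMul_apply, opPow_latDeriv_apply, smul_eq_mul]

/-- In the leading coefficient along `∂_i` of an operator of the ideal, every monomial contains the
`i`-th coordinate. -/
lemma ne_zero_of_mem_support_coeff {L : Weyl} (hL : L ∈ picardFuchs)
    {f : MvPolynomial (Fin 3) Poly} (hf : ofSymbol f = (L : Module.End ℂ Poly)) (i : Fin 3)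
    {β : Fin 3 →₀ ℕ} (hβ : β ∈ (f.coeff (Finsupp.single i f.totalDegree)).support) : β i ≠ 0 := by
  have hzero : symAct latMul latDeriv f (cutoff seriesCoeff) = 0 :=
    symAct_mem_of_mem_span isWeylRep_lat (S := ⊥) (by simp) (by simp)
      (fun L hL => by rw [lat_cutoff_series hL]; exact Submodule.zero_mem _) hL hf
  set m := f.totalDegree with hm
  intro hi
  -- Take `β` minimal and look at the coefficient of the index `β - m e_i`: the only term of `f`
  -- that contributes is `x ^ β ∂_i ^ m`, as the cut-off series vanishes at indices with a negative
  -- entry.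
  obtain ⟨β, hβ, hmin⟩ :=
    ((f.coeff (Finsupp.single i m)).support.filter (fun β => β i = 0)).exists_minimal
      ⟨β, Finset.mem_filter.2 ⟨hβ, hi⟩⟩
  clear hi
  obtain ⟨hβs, hβi⟩ := Finset.mem_filter.1 hβ
  have hγ := congrFun hzero ((fun j => (β j : ℤ)) - Pi.single i (m : ℤ))
  rw [symAct_lat_apply, Finset.sum_eq_single (Finsupp.single i m), Finset.sum_eq_single β] at hγ
  · have h0 : ((fun j => (β j : ℤ)) - Pi.single i (m : ℤ) - fun j => (β j : ℤ)) +
        (fun j => ((Finsupp.single i m j : ℕ) : ℤ)) = 0 := by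
      ext j
      by_cases hj : j = i
      · subst hj; simp
      · simp [hj, Finsupp.single_apply, Ne.symm hj]
    rw [h0, Pi.zero_apply, mul_eq_zero, mul_eq_zero] at hγ
    rcases hγ with h | h | h
    · exact mem_support_iff.1 hβs h
    · obtain ⟨j, -, hj⟩ := Finset.prod_eq_zero_iff.1 h
      obtain ⟨k, hk, hk'⟩ := Finset.prod_eq_zero_iff.1 hj
      rw [Finset.mem_range] at hk
      have hji : j ≠ i := by rintro rfl; lia
      rw [Pi.sub_apply, Pi.single_eq_of_ne hji, sub_zero, sub_eq_zero] at hk'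
      have : β j = k := by exact_mod_cast hk'
      lia
    · simp [cutoff_apply, seriesCoeff, pochCoeff, invFactorial] at h
  · intro β' hβ' hne
    rw [cutoff_apply, if_neg, mul_zero, mul_zero]
    intro hpos
    have hle : ∀ j, β' j ≤ β j ∧ (j = i → β' j = 0) := by
      intro j
      have := hpos j
      by_cases hj : j = i
      · subst hj
        simp [hβi] at this
        lia
      · simp [hj, Finsupp.single_apply, Ne.symm hj] at this
        exact ⟨this, fun h => absurd h hj⟩
    have hle' : β' ≤ β := fun j => (hle j).1
    exact hne (le_antisymm hle' (hmin (Finset.mem_filter.2 ⟨hβ', (hle i).2 rfl⟩) hle'))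
  · exact fun h => absurd hβs h
  · intro α hα hne
    refine Finset.sum_eq_zero fun β' _ => ?_
    rw [cutoff_apply, if_neg, mul_zero, mul_zero]
    intro hpos
    have h1 := hpos i
    simp [hβi] at h1
    have h2 := le_totalDegree_of_mem hα
    rw [Finsupp.degree_eq_sum, Fin.sum_univ_three, ← hm] at h2
    apply hne
    ext j
    rw [Finsupp.single_apply]
    fin_cases i <;> fin_cases j <;> simp at h1 ⊢ <;> lia
  · intro h
    have : f.coeff (Finsupp.single i m) = 0 := by simpa using h
    rw [this]
    simp

/-- The conormal direction of a coordinate hyperplane is characteristic. -/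
lemma coordHyperplane_mem_charVariety {x : Fin 3 → ℂ} {i : Fin 3} (hx : x i = 0) :
    (x, Pi.single i 1) ∈ charVariety picardFuchs := by
  intro L hL f hf
  rw [principalSymbolAt_eq_sum]
  refine Finset.sum_eq_zero fun α hα => ?_
  obtain ⟨-, hdeg⟩ := Finset.mem_filter.1 hα
  by_cases h : α = Finsupp.single i f.totalDegree
  · rw [h, eval_eq, Finset.sum_eq_zero, zero_mul]
    intro β hβ
    rw [Finset.prod_eq_zero (Finsupp.mem_support_iff.2 (ne_zero_of_mem_support_coeff hL hf i hβ))
      (by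
        change x i ^ β i = 0
        rw [hx, zero_pow (ne_zero_of_mem_support_coeff hL hf i hβ)]), mul_zero]
  · have : ∃ j, j ≠ i ∧ α j ≠ 0 := by
      by_contra! hj
      apply h
      have hα : α = Finsupp.single i (α i) := by
        ext j
        by_cases hji : j = i
        · subst hji; simp
        · rw [hj j hji, Finsupp.single_eq_of_ne hji]
      rw [hα, Finsupp.degree_single] at hdeg
      rw [hα, ← hdeg]
    obtain ⟨j, hji, hj⟩ := this
    have h0 : (Pi.single i 1 : Fin 3 → ℂ) j ^ α j = 0 := by
      rw [Pi.single_eq_of_ne hji, zero_pow hj]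
    fin_cases j <;> simp only [Fin.zero_eta, Fin.mk_one, Fin.reduceFinMk] at h0 <;> simp [h0]

end CoordinatePlanes

/-! ### The characteristic variety outside the coordinate planes -/

section Outside

open MvPolynomial

lemma weylRep_poly (L : Weyl) : weylRep isWeylRep_poly L = (L : Module.End ℂ Poly) := by
  obtain ⟨f, hf⟩ := exists_symbol_of_mem_weylGraph isWeylRep_poly
    (exists_weylRep_mem isWeylRep_poly L)
  rw [weylRep_of_symbol isWeylRep_poly (congrArg Prod.fst hf).symm, ← ofSymbol_eq_symAct]
  exact (congrArg Prod.fst hf).symm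

lemma ofSymbol_add (f g : MvPolynomial (Fin 3) Poly) :
    ofSymbol (f + g) = ofSymbol f + ofSymbol g := by
  simp only [ofSymbol_eq_symAct, symAct_add]

lemma ofSymbol_C_mul (a : Poly) (f : MvPolynomial (Fin 3) Poly) (g : Poly) :
    ofSymbol (C a * f) g = a * ofSymbol f g := by
  rw [ofSymbol_eq_symAct, ofSymbol_eq_symAct]
  induction f using MvPolynomial.induction_on' with
  | monomial α b =>
    rw [C_mul_monomial, symAct_monomial, symAct_monomial, polyAct_mulX, polyAct_mulX]
    simp only [Module.End.mul_apply, LinearMap.mulLeft_apply, mul_assoc]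
  | add f₁ f₂ h₁ h₂ =>
    rw [mul_add, symAct_add, symAct_add, LinearMap.add_apply, LinearMap.add_apply, h₁, h₂, mul_add]

lemma ofSymbol_X (i : Fin 3) (g : Poly) : ofSymbol (X i) g = pderiv i g := by
  have h := D_mul_symAct isWeylRep_poly 1 i
  have h0 : coeffDeriv i 1 = 0 := by
    rw [← C_1, ← monomial_zero', coeffDeriv_monomial]; simp
  rw [symAct_one, h0, mul_one, mul_one, add_zero] at h
  rw [ofSymbol_eq_symAct, ← h]
  rfl

lemma ofSymbol_X_mul_X (i j : Fin 3) (g : Poly) :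
    ofSymbol (X i * X j) g = pderiv i (pderiv j g) := by
  have h := D_mul_symAct isWeylRep_poly (X j) i
  have h0 : coeffDeriv i (X j) = 0 := by
    rw [MvPolynomial.X, coeffDeriv_monomial]; simp
  rw [h0, add_zero, ← ofSymbol_eq_symAct, ← ofSymbol_eq_symAct] at h
  rw [← h, Module.End.mul_apply, ofSymbol_X]
  rfl

lemma ofSymbol_one (g : Poly) : ofSymbol 1 g = g := by
  rw [ofSymbol_eq_symAct, symAct_one]; rfl

/-- The condition on characteristic covectors given by an operator of order at most two. -/
lemma quadratic_symbol_eq_zero {I : Ideal Weyl} {x ξ : Fin 3 → ℂ} (h : (x, ξ) ∈ charVariety I)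
    {L : Weyl} (hL : L ∈ I) {a₀₀ a₀₁ a₀₂ a₁₁ a₁₂ a₂₂ b₀ b₁ b₂ k : Poly}
    (hact : ∀ g : Poly, weylRep isWeylRep_poly L g =
      (a₀₀ * pderiv 0 (pderiv 0 g) + a₀₁ * pderiv 0 (pderiv 1 g) + a₀₂ * pderiv 0 (pderiv 2 g)
        + a₁₁ * pderiv 1 (pderiv 1 g) + a₁₂ * pderiv 1 (pderiv 2 g)
        + a₂₂ * pderiv 2 (pderiv 2 g))
        + (b₀ * pderiv 0 g + b₁ * pderiv 1 g + b₂ * pderiv 2 g + k * g)) :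
    MvPolynomial.eval x a₀₀ * (ξ 0 * ξ 0) + MvPolynomial.eval x a₀₁ * (ξ 0 * ξ 1)
      + MvPolynomial.eval x a₀₂ * (ξ 0 * ξ 2) + MvPolynomial.eval x a₁₁ * (ξ 1 * ξ 1)
      + MvPolynomial.eval x a₁₂ * (ξ 1 * ξ 2) + MvPolynomial.eval x a₂₂ * (ξ 2 * ξ 2) = 0 := by
  have hhom : ∀ (a : Poly) (i j : Fin 3),
      (C a * (X i * X j) : MvPolynomial (Fin 3) Poly).IsHomogeneous 2 := fun a i j =>
    (((isHomogeneous_X _ i).mul (isHomogeneous_X _ j)).C_mul a)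
  have hlin : ∀ (b : Poly) (i : Fin 3),
      (C b * X i : MvPolynomial (Fin 3) Poly).totalDegree ≤ 1 := fun b i =>
    ((isHomogeneous_X _ i).C_mul b).totalDegree_le
  let f : MvPolynomial (Fin 3) Poly := C a₀₀ * (X 0 * X 0) + C a₀₁ * (X 0 * X 1)
    + C a₀₂ * (X 0 * X 2) + C a₁₁ * (X 1 * X 1) + C a₁₂ * (X 1 * X 2) + C a₂₂ * (X 2 * X 2)
  let g : MvPolynomial (Fin 3) Poly := C b₀ * X 0 + C b₁ * X 1 + C b₂ * X 2 + C k * 1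
  have hf : f.IsHomogeneous 2 :=
    ((((((hhom _ _ _).add (hhom _ _ _)).add (hhom _ _ _)).add (hhom _ _ _)).add
      (hhom _ _ _)).add (hhom _ _ _))
  have hg : g.totalDegree < 2 := by
    refine Nat.lt_succ_of_le ?_
    refine (totalDegree_add _ _).trans (max_le ((totalDegree_add _ _).trans (max_le
      ((totalDegree_add _ _).trans (max_le (hlin _ _) (hlin _ _))) (hlin _ _))) (by simp))
  have hfg : ofSymbol (f + g) = (L : Module.End ℂ Poly) := LinearMap.ext fun v => by
    rw [← weylRep_poly, hact]
    simp only [f, g, ofSymbol_add, LinearMap.add_apply, ofSymbol_C_mul, ofSymbol_X_mul_X,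
      ofSymbol_X, ofSymbol_one]
  have key : MvPolynomial.eval ξ (map (MvPolynomial.eval x) f) = 0 := by
    by_cases hf0 : f = 0
    · simp [hf0]
    · rw [← principalSymbolAt_add hf hf0 hg]
      exact h L hL _ hfg
  simpa [f] using key

lemma mem_picardFuchs : gkz1 ∈ picardFuchs ∧ gkz2 ∈ picardFuchs ∧ gkz3 ∈ picardFuchs ∧
    gkz4 ∈ picardFuchs :=
  ⟨Ideal.subset_span (by simp), Ideal.subset_span (by simp), Ideal.subset_span (by simp),
    Ideal.subset_span (by simp)⟩

variable {x ξ : Fin 3 → ℂ}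

lemma symbol_gkz1 (h : (x, ξ) ∈ charVariety picardFuchs) :
    x 0 * x 1 ^ 2 * x 2 * (ξ 0 * ξ 2 - ξ 1 ^ 2) = 0 := by
  have := quadratic_symbol_eq_zero h mem_picardFuchs.1 (a₀₀ := 0) (a₀₁ := 0)
    (a₀₂ := X 0 * X 1 ^ 2 * X 2) (a₁₁ := -(X 0 * X 1 ^ 2 * X 2)) (a₁₂ := 0) (a₂₂ := 0)
    (b₀ := 0) (b₁ := 0) (b₂ := 0) (k := 0) (fun g => by
      rw [weylRep_gkz1_apply]
      simp only [mulX_apply, partialD_apply, pderiv_mul, map_sub, pderiv_X]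
      simp
      ring)
  simp at this
  linear_combination this

lemma symbol_gkz2 (h : (x, ξ) ∈ charVariety picardFuchs) :
    x 0 ^ 2 * x 1 * (x 1 * ξ 1 ^ 2 + 2 * x 2 * ξ 1 * ξ 2 - ξ 0 ^ 2) = 0 := by
  have := quadratic_symbol_eq_zero h mem_picardFuchs.2.1 (a₀₀ := -(X 0 ^ 2 * X 1)) (a₀₁ := 0)
    (a₀₂ := 0) (a₁₁ := X 0 ^ 2 * X 1 ^ 2) (a₁₂ := C 2 * X 0 ^ 2 * X 1 * X 2) (a₂₂ := 0)
    (b₀ := 0) (b₁ := X 0 ^ 2 * X 1) (b₂ := 0) (k := 0) (fun g => by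
      rw [weylRep_gkz2_apply]
      simp only [mulX_apply, partialD_apply, pderiv_mul, map_sub, map_add, pderiv_X,
        MvPolynomial.smul_eq_C_mul, pderiv_C]
      simp
      ring)
  simp at this
  linear_combination this

lemma symbol_gkz3 (h : (x, ξ) ∈ charVariety picardFuchs) :
    x 0 * (x 0 * ξ 0 + 2 * x 1 * ξ 1 + 3 * x 2 * ξ 2) *
      (ξ 0 - (x 0 * ξ 0 + 2 * x 1 * ξ 1 + 3 * x 2 * ξ 2)) = 0 := by
  have := quadratic_symbol_eq_zero h mem_picardFuchs.2.2.1 (a₀₀ := X 0 ^ 2 - X 0 ^ 3)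
    (a₀₁ := C 2 * X 0 * X 1 - C 4 * X 0 ^ 2 * X 1) (a₀₂ := C 3 * X 0 * X 2 - C 6 * X 0 ^ 2 * X 2)
    (a₁₁ := -(C 4 * X 0 * X 1 ^ 2)) (a₁₂ := -(C 12 * X 0 * X 1 * X 2))
    (a₂₂ := -(C 9 * X 0 * X 2 ^ 2)) (b₀ := X 0 - C 2 * X 0 ^ 2) (b₁ := -(C 6 * X 0 * X 1))
    (b₂ := -(C 12 * X 0 * X 2)) (k := -(C (1 / 2) ^ 2 * X 0)) (fun g => by
      have h1 := LinearMap.congr_fun (isWeylRep_poly.comm_D 1 0) g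
      have h2 := LinearMap.congr_fun (isWeylRep_poly.comm_D 2 0) g
      have h3 := LinearMap.congr_fun (isWeylRep_poly.comm_D 2 1) g
      have hh : (2 : Poly) * C (1 / 2) = 1 := by
        rw [← map_ofNat C 2, ← C_mul]; norm_num
      rw [weylRep_gkz3_apply]
      simp only [mulX_apply, partialD_apply, pderiv_mul, map_add, pderiv_X, Module.End.mul_apply,
        MvPolynomial.smul_eq_C_mul, pderiv_C] at h1 h2 h3 ⊢
      simp only [h1, h2, h3]
      generalize (C (1 / 2) : Poly) = η at hh ⊢
      simp
      simp only [map_ofNat C 2, map_ofNat C 3, map_ofNat C 4, map_ofNat C 6, map_ofNat C 9,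
        map_ofNat C 12]
      linear_combination -(X 0 * (X 0 * pderiv 0 g + 2 * X 1 * pderiv 1 g
        + 3 * X 2 * pderiv 2 g)) * hh)
  simp at this
  linear_combination this

lemma symbol_gkz4 (h : (x, ξ) ∈ charVariety picardFuchs) :
    x 0 * x 1 * x 2 * (x 1 * ξ 1 * ξ 2 + 2 * x 2 * ξ 2 ^ 2 - ξ 0 * ξ 1) = 0 := by
  have := quadratic_symbol_eq_zero h mem_picardFuchs.2.2.2 (a₀₀ := 0) (a₀₁ := -(X 0 * X 1 * X 2))
    (a₀₂ := 0) (a₁₁ := 0) (a₁₂ := X 0 * X 1 ^ 2 * X 2) (a₂₂ := C 2 * X 0 * X 1 * X 2 ^ 2)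
    (b₀ := 0) (b₁ := 0) (b₂ := C 2 * X 0 * X 1 * X 2) (k := 0) (fun g => by
      have h3 := LinearMap.congr_fun (isWeylRep_poly.comm_D 2 1) g
      rw [weylRep_gkz4_apply]
      simp only [mulX_apply, partialD_apply, pderiv_mul, map_add, pderiv_X,
        MvPolynomial.smul_eq_C_mul, pderiv_C, Module.End.mul_apply] at h3 ⊢
      rw [h3]
      simp
      ring)
  simp at this
  linear_combination this

/-- If `t` is a common root of `t³ + p t² + q t + r` and its derivative, so that `q` and `r` are the
given expressions in `p` and `t`, then `d₃ = 0`. -/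
lemma d₃_doubleRoot (p t : ℂ) : d₃ p (-3 * t ^ 2 - 2 * p * t) (2 * t ^ 3 + p * t ^ 2) = 0 := by
  unfold d₃; ring

/-- The cubic `R₂` is `R₃` with `p` replaced by `p - 1`. -/
lemma d₂_eq_d₃ (p q r : ℂ) : d₂ p q r = d₃ (p - 1) q r := by
  unfold d₂ d₃; ring

/-- Where `d₃` vanishes, `t³ + p t² + q t + r` has a double root. -/
lemma exists_doubleRoot {p q r : ℂ} (h : d₃ p q r = 0) :
    ∃ t, q = -3 * t ^ 2 - 2 * p * t ∧ r = 2 * t ^ 3 + p * t ^ 2 := by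
  unfold d₃ at h
  -- If `p² = 3 q` then the double root is triple; otherwise it is `(9 r - p q) / (2 (p² - 3 q))`.
  by_cases hD : p ^ 2 - 3 * q = 0
  · obtain rfl : q = p ^ 2 / 3 := by linear_combination -hD / 3
    have hr : (27 * r - p ^ 3) ^ 2 = 0 := by linear_combination 27 * h
    rw [sq_eq_zero_iff] at hr
    exact ⟨-p / 3, by ring, by linear_combination hr / 27⟩
  · obtain ⟨t, ht⟩ : ∃ t, 2 * (p ^ 2 - 3 * q) * t = 9 * r - p * q :=
      ⟨(9 * r - p * q) / (2 * (p ^ 2 - 3 * q)), by field_simp⟩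
    set D := p ^ 2 - 3 * q with hDdef
    set N := 9 * r - p * q with hNdef
    refine ⟨t, mul_left_cancel₀ (mul_ne_zero (by norm_num : (4 : ℂ) ≠ 0) (pow_ne_zero 2 hD)) ?_,
      mul_left_cancel₀ (mul_ne_zero (by norm_num : (4 : ℂ) ≠ 0) (pow_ne_zero 3 hD)) ?_⟩
    · linear_combination 9 * h + (3 * (2 * D * t + N) + 4 * p * D) * ht
    · linear_combination (p ^ 3 - 27 * r) * h
        - ((2 * D * t) ^ 2 + 2 * D * t * N + N ^ 2) * ht - p * D * (2 * D * t + N) * ht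

/-- Outside the coordinate planes, a nonzero characteristic covector is proportional to
`(t², t, 1)`, where `t` is a double root of one of the two cubics. The cubic is `R₃` or `R₂`
according to which of the two linear factors of the symbol of `gkz3` vanishes. -/
lemma discriminant_eq_zero_of_mem_charVariety {p q r : ℂ} (hp : p ≠ 0) (hq : q ≠ 0) (hr : r ≠ 0)
    (h : (![p, q, r], ξ) ∈ charVariety picardFuchs) (hξ : ξ ≠ 0) :
    d₂ p q r = 0 ∨ d₃ p q r = 0 := by
  have h1 := symbol_gkz1 h
  have h2 := symbol_gkz2 h
  have h3 := symbol_gkz3 h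
  have h4 := symbol_gkz4 h
  simp only [Matrix.cons_val, mul_eq_zero, pow_eq_zero_iff, ne_eq, OfNat.ofNat_ne_zero,
    not_false_eq_true, hp, hq, hr, false_or] at h1 h2 h3 h4
  have hξ2 : ξ 2 ≠ 0 := by
    intro h0
    rw [h0] at h1 h2
    have e1 : ξ 1 = 0 := by
      have : ξ 1 ^ 2 = 0 := by linear_combination -h1
      simpa using this
    rw [e1] at h2
    have e0 : ξ 0 = 0 := by
      have : ξ 0 ^ 2 = 0 := by linear_combination -h2
      simpa using this
    exact hξ (by ext i; fin_cases i <;> simp [e0, e1, h0])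
  obtain ⟨t, ht⟩ : ∃ t, ξ 1 = t * ξ 2 := ⟨ξ 1 / ξ 2, by field_simp⟩
  have h0 : ξ 0 = t ^ 2 * ξ 2 := mul_right_cancel₀ hξ2 (by rw [ht] at h1; linear_combination h1)
  rw [h0, ht] at h3 h4
  have ht3 : t ^ 3 = q * t + 2 * r := by
    have : (ξ 2) ^ 2 * (t ^ 3 - (q * t + 2 * r)) = 0 := by linear_combination -h4
    have := (mul_eq_zero.1 this).resolve_left (pow_ne_zero 2 hξ2)
    linear_combination this
  have ht0 : t ≠ 0 := by
    rintro rfl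
    exact hr (by linear_combination -ht3 / 2)
  rcases h3 with h3 | h3
  · right
    have hA : p * t ^ 2 + 2 * q * t + 3 * r = 0 :=
      (mul_eq_zero.1 (show ξ 2 * (p * t ^ 2 + 2 * q * t + 3 * r) = 0 by
        linear_combination h3)).resolve_left hξ2
    have eq : q = -3 * t ^ 2 - 2 * p * t := mul_left_cancel₀ ht0 (by
      linear_combination 2 * hA + 3 * ht3)
    have er : r = 2 * t ^ 3 + p * t ^ 2 := by
      linear_combination -2 * ht3 - hA
    rw [eq, er]
    exact d₃_doubleRoot p t
  · left
    have hA : (p - 1) * t ^ 2 + 2 * q * t + 3 * r = 0 :=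
      (mul_eq_zero.1 (show ξ 2 * ((p - 1) * t ^ 2 + 2 * q * t + 3 * r) = 0 by
        linear_combination -h3)).resolve_left hξ2
    have eq : q = -3 * t ^ 2 - 2 * (p - 1) * t := mul_left_cancel₀ ht0 (by
      linear_combination 2 * hA + 3 * ht3)
    have er : r = 2 * t ^ 3 + (p - 1) * t ^ 2 := by
      linear_combination -2 * ht3 - hA
    rw [d₂_eq_d₃, eq, er]
    exact d₃_doubleRoot (p - 1) t

end Outside

/-! ### The singular locus -/

section Locus

/-- The conormal direction `(1, 1 / t, 1 / t²)` at a point where `d₃` vanishes after translating `p`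
by `ε`; off the coordinate planes the double root `t` is not zero. -/
lemma mem_singularLocus_of_discriminant {ε p q r : ℂ} (hε : ε = 0 ∨ ε = 1) (hq : q ≠ 0)
    (hr : r ≠ 0) (h : d₃ (p - ε) q r = 0) : ![p, q, r] ∈ singularLocus picardFuchs := by
  obtain ⟨t, rfl, rfl⟩ := exists_doubleRoot h
  have ht : t ≠ 0 := by
    rintro rfl
    exact hr (by ring)
  have hmem := doubleRoot_mem_charVariety hε hq hr ht (by field_simp; ring)
  have hp : ε - (t + (-3 * t ^ 2 - 2 * (p - ε) * t) * t⁻¹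
      + (2 * t ^ 3 + (p - ε) * t ^ 2) * t⁻¹ ^ 2) = p := by
    field_simp
    ring
  rw [hp] at hmem
  exact ⟨_, fun h0 => one_ne_zero (congrFun h0 0), hmem⟩

lemma mem_singularLocus_iff {p q r : ℂ} : ![p, q, r] ∈ singularLocus picardFuchs ↔
    p = 0 ∨ q = 0 ∨ r = 0 ∨ d₂ p q r = 0 ∨ d₃ p q r = 0 := by
  have hplane : ∀ i, ![p, q, r] i = 0 → ![p, q, r] ∈ singularLocus picardFuchs := fun i hi =>
    ⟨Pi.single i 1, by simp, coordHyperplane_mem_charVariety hi⟩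
  constructor
  · rintro ⟨ξ, hξ, h⟩
    by_cases hp : p = 0
    · exact Or.inl hp
    by_cases hq : q = 0
    · exact Or.inr (Or.inl hq)
    by_cases hr : r = 0
    · exact Or.inr (Or.inr (Or.inl hr))
    exact Or.inr (Or.inr (Or.inr (discriminant_eq_zero_of_mem_charVariety hp hq hr h hξ)))
  · intro h
    by_cases hq : q = 0
    · exact hplane 1 hq
    by_cases hr : r = 0
    · exact hplane 2 hr
    rcases h with h | h | h | h | h
    · exact hplane 0 h
    · exact absurd h hq
    · exact absurd h hr
    · exact mem_singularLocus_of_discriminant (Or.inr rfl) hq hr (d₂_eq_d₃ p q r ▸ h)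
    · exact mem_singularLocus_of_discriminant (Or.inl rfl) hq hr (by rwa [sub_zero])

end Locus

end

end KummerPF

theorem corollary2p2 :
    KummerPF.singularLocus KummerPF.picardFuchs =
        {x : Fin 3 → ℂ | x 0 = 0} ∪ {x : Fin 3 → ℂ | x 1 = 0} ∪ {x : Fin 3 → ℂ | x 2 = 0} ∪
          {x : Fin 3 → ℂ | KummerPF.d₂ (x 0) (x 1) (x 2) = 0} ∪
          {x : Fin 3 → ℂ | KummerPF.d₃ (x 0) (x 1) (x 2) = 0} ∧
      (∀ p q r : ℂ, (KummerPF.R₂ p q r).discr = -KummerPF.d₂ p q r ∧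
        (KummerPF.R₃ p q r).discr = -KummerPF.d₃ p q r) ∧
      ¬ {x : Fin 3 → ℂ | KummerPF.d₁ (x 0) (x 1) (x 2) = 0} ⊆
          KummerPF.singularLocus KummerPF.picardFuchs := by
  refine ⟨?_, fun p q r => ?_, fun h => ?_⟩
  · ext x
    have hx : x = ![x 0, x 1, x 2] := by ext i; fin_cases i <;> rfl
    nth_rw 1 [hx]
    rw [KummerPF.mem_singularLocus_iff]
    simp only [Set.mem_union, Set.mem_ofPred_eq, or_assoc]
  · unfold KummerPF.R₂ KummerPF.R₃ KummerPF.d₂ KummerPF.d₃ Cubic.discr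
    constructor <;> ring
  · -- At `p = 1` the equation `d₁ = 0` is solved by `27 r = 8 q`, `27 q = 32`.
    have hd : KummerPF.d₁ 1 (32 / 27) (256 / 729) = 0 := by norm_num [KummerPF.d₁]
    have h1 := @h ![1, 32 / 27, 256 / 729] (by
      simpa only [Set.mem_ofPred_eq, Matrix.cons_val] using hd)
    rw [KummerPF.mem_singularLocus_iff] at h1
    norm_num [KummerPF.d₂, KummerPF.d₃] at h1
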